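/- Let $\Omega\subset\mathbb C$ be a bounded simply connected domain whose boundary $\Gamma=\partial\Omega$ is a smooth analytic closed (Jordan) curve, positively oriented with respect to $\Omega$. Let $\mathbb P=\mathbb C\cup\{\infty\}$ be the Riemann sphere, $\Omega^e=\mathbb P\setminus\overline\Omega$ (so $\infty\in\Omega^e$), and let $S$ be the Schwarz function of $\Gamma$: a holomorphic function on an open neighbourhood $V$ of $\Gamma$ with $S(z)=\bar z$ on $\Gamma$. *Line bundles.* A nonvanishing holomorphic function $\lambda_{12}$ on an open neighbourhood $N$ of $\Gamma$ defines a line bundle on $\mathbb P$ with charts $U_1=\Omega\cup N$, $U_2=\Omega^e\cup N$ (so $U_1\cap U_2=N$). A holomorphic section is a pair $(f_1,f_2)$, with $f_j$ holomorphic on $U_j$ and $f_1=\lambda_{12}f_2$ on $N$. For $w\in\mathbb C\setminus\Gamma$ let $\lambda_w$ be the bundle with $\lambda_{12}(z)=\dfrac1{S(z)-\bar w}$ on $N=\{z\in V: S(z)\ne\bar w\}$, and let $e^S$ be the bundle with $\lambda_{12}=e^{S}$ on $N=V$. *Transforms.* Put $$C_\Omega(z,w)=\frac1{2\pi i}\int_\Omega\frac{d\zeta\wedge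 d\bar\zeta}{(\zeta-z)(\bar\zeta-\bar w)},\qquad E_\Omega(z,w)=\exp C_\Omega(z,w),$$ with $E_\Omega=0$ where the integral diverges (to $-\infty$; this happens only for $z=w$), and $$F(z,w)=E_\Omega(z,w)\ (z,w\in\Omega^e\setminus\{\infty\}),\qquad G(z,w)=\frac{E_\Omega(z,w)}{\bar z-\bar w}\ (z\in\Omega,\ w\in\Omega^e\setminus\{\infty\}),$$ $$G^*(z,w)=\overline{G(w,z)}\ (z\in\Omega^e\setminus\{\infty\},\ w\in\Omega),\qquad H(z,w)=\frac{E_\Omega(z,w)}{|z-w|^2}\ (z,w\in\Omega),$$ where $H(w,w)$ is defined by the limit $z\to w$. Put also $$C_\Omega(z)=\frac1{2\pi i}\int_\Omega\frac{d\zeta\wedge d\bar\zeta}{\zeta-z}\ (z\in\Omega^e\setminus\{\infty\}),\qquad C_{\Omega^e}(z)=\frac1{2\pi i}\oint_\Gamma\frac{\bar\zeta\,d\zeta}{\zeta-z}\ (z\in\Omega).$$ **Theorem.** In each statement below, the pair of functions, given on $\Omega$ and on $\Omega^e\setminus\{\infty\}$, extends to a pair of holomorphic functions on $U_1$ and $U_2$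 (denoted by the same letters), and this pair is the unique holomorphic section of the bundle with the stated normalization. 1. For each $w\in\Omega^e\setminus\{\infty\}$: the pair $(G(\cdot,w),F(\cdot,w))$ and the bundle $\lambda_w$, normalized by $F(\infty,w)=1$. Explicitly, $G(z,w)(S(z)-\bar w)=F(z,w)$ for $z\in U_1\cap U_2$. 2. For each $w\in\Omega$: the pair $(H(\cdot,w),-G^*(\cdot,w))$ and the bundle $\lambda_w$, normalized by $-G^*(z,w)=z^{-1}+O(z^{-2})$ as $z\to\infty$. Explicitly, $H(z,w)(S(z)-\bar w)=-G^*(z,w)$ for $z\in U_1\cap U_2$. 3. The same holds in the other variable: for fixed $z\in\Omega^e\setminus\{\infty\}$ the pair $w\mapsto\big(\overline{G^*(z,w)},\overline{F(z,w)}\big)$ is the unique holomorphic section of $\lambda_z$ with value one at infinity, and for fixed $z\in\Omega$ the pair $w\mapsto\big(\overline{H(z,w)},-\overline{G(z,w)}\big)$ is the unique holomorphic section of $\lambda_z$ of the form $w^{-1}+O(w^{-2})$ as $w\to\infty$, with the corresponding explicit relations on the overlap. 4. The pair $\big(e^{C_{\Omega^e}},e^{-C_\Omega}\big)$ is the unique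 holomorphic section of the bundle $e^{S}$ with value one at infinity. It is the limiting case $w\to\infty$ of 1: with principal powers, as $w\to\infty$, $$\Big(\frac{-\bar w}{S(z)-\bar w}\Big)^{\bar w}\to e^{S(z)}\ (z\in V),\qquad \big(-\bar w\,G(z,w)\big)^{\bar w}\to e^{C_{\Omega^e}(z)}\ (z\in\Omega),\qquad F(z,w)^{\bar w}\to e^{-C_\Omega(z)}\ (z\in\Omega^e\setminus\{\infty\}).$$ -/

import Mathlib

open Set Filter Topology MeasureTheory Asymptotics
open scoped ComplexConjugate OnePoint

noncomputable section

namespace SchwarzBundle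

/-! ### Line bundles on the Riemann sphere given by two charts -/

/-- The inverse of the coordinate `1 / z` of the Riemann sphere `ℂ ∪ {∞}` at infinity. -/
def invChart (u : ℂ) : OnePoint ℂ := if u = 0 then ∞ else ((u⁻¹ : ℂ) : OnePoint ℂ)

/-- `f` is holomorphic near the point `x` of the Riemann sphere: it is analytic in the coordinate
`z` at a finite point, and in the coordinate `1 / z` at infinity. -/
def HolomorphicAt (f : OnePoint ℂ → ℂ) (x : OnePoint ℂ) : Prop :=
  x.elim (AnalyticAt ℂ (fun u : ℂ => f (invChart u)) 0)
    (fun z => AnalyticAt ℂ (fun u : ℂ => f (u : OnePoint ℂ)) z)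

/-- `f` is holomorphic on a neighbourhood of each point of `U`. -/
def HolomorphicOn (f : OnePoint ℂ → ℂ) (U : Set (OnePoint ℂ)) : Prop :=
  ∀ x ∈ U, HolomorphicAt f x

/-- A line bundle on the Riemann sphere, represented by a covering by two open sets and a
nonvanishing holomorphic transition function `t = λ₁₂` on their intersection. -/
structure LineBundle where
  U₁ : Set (OnePoint ℂ)
  U₂ : Set (OnePoint ℂ)
  isOpen₁ : IsOpen U₁
  isOpen₂ : IsOpen U₂
  cover : U₁ ∪ U₂ = univ
  t : OnePoint ℂ → ℂ
  holomorphic_t : HolomorphicOn t (U₁ ∩ U₂)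
  t_ne_zero : ∀ x ∈ U₁ ∩ U₂, t x ≠ 0

/-- A holomorphic section: a pair of holomorphic functions on `U₁`, `U₂` with `f₁ = λ₁₂ f₂` on
`U₁ ∩ U₂`. -/
def LineBundle.IsSection (L : LineBundle) (f₁ f₂ : OnePoint ℂ → ℂ) : Prop :=
  HolomorphicOn f₁ L.U₁ ∧ HolomorphicOn f₂ L.U₂ ∧ ∀ x ∈ L.U₁ ∩ L.U₂, f₁ x = L.t x * f₂ x

/-- `(f₁, f₂)` is the unique holomorphic section of `L` whose second component satisfies the
normalization `P`. -/
def LineBundle.IsUniqueSection (L : LineBundle) (P : (OnePoint ℂ → ℂ) → Prop)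
    (f₁ f₂ : OnePoint ℂ → ℂ) : Prop :=
  L.IsSection f₁ f₂ ∧ P f₂ ∧
    ∀ g₁ g₂ : OnePoint ℂ → ℂ, L.IsSection g₁ g₂ → P g₂ → EqOn g₁ f₁ L.U₁ ∧ EqOn g₂ f₂ L.U₂

/-- Normalization: the value at infinity is one. -/
def ValueOne (f : OnePoint ℂ → ℂ) : Prop := f ∞ = 1

/-- Normalization: `f z = 1 / z + O (1 / z ^ 2)` as `z → ∞`. -/
def LeadingTermInv (f : OnePoint ℂ → ℂ) : Prop :=
  (fun z : ℂ => f z - 1 / z) =O[Bornology.cobounded ℂ] (fun z : ℂ => 1 / z ^ 2)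

/-! ### The domain, its exterior and the Schwarz function -/

/-- The finite part `Ωᵉ ∖ {∞}` of the exterior domain. -/
def exterior (Ω : Set ℂ) : Set ℂ := (closure Ω)ᶜ

/-- `Ω` is a bounded simply connected domain whose boundary is a smooth analytic closed curve, and
`γ` (of period `2π`) is a regular analytic parametrization of the boundary, positively oriented:
it has winding number one about the points of `Ω`. -/
structure IsAnalyticDomain (Ω : Set ℂ) (γ : ℝ → ℂ) : Prop where
  isOpen : IsOpen Ω
  isBounded : Bornology.IsBounded Ω
  simplyConnected : IsSimplyConnected Ω
  analytic : AnalyticOnNhd ℝ γ univ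
  periodic : Function.Periodic γ (2 * Real.pi)
  deriv_ne_zero : ∀ s, deriv γ s ≠ 0
  injOn : InjOn γ (Ico 0 (2 * Real.pi))
  range_eq : range γ = frontier Ω
  winding : ∀ a ∈ Ω, (1 / (2 * Real.pi * Complex.I)) *
    (∫ s in (0 : ℝ)..(2 * Real.pi), deriv γ s / (γ s - a)) = 1

/-- `S`, on the open set `V`, is the Schwarz function of `∂Ω`. -/
structure IsSchwarzFunction (Ω V : Set ℂ) (S : ℂ → ℂ) : Prop where
  isOpen : IsOpen V
  frontier_subset : frontier Ω ⊆ V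
  holomorphic : DifferentiableOn ℂ S V
  eq_conj : ∀ z ∈ frontier Ω, S z = conj z

/-- The line bundle on the Riemann sphere defined by a nonvanishing holomorphic function `t` on a
neighbourhood `N` of `∂Ω`: the charts are `U₁ = Ω ∪ N` and `U₂ = Ωᵉ ∪ N`, so that
`U₁ ∩ U₂ = N`. -/
def glue (Ω N : Set ℂ) (t : ℂ → ℂ) (hΩ : IsOpen Ω) (hb : Bornology.IsBounded Ω) (hN : IsOpen N)
    (hΓ : frontier Ω ⊆ N) (ht : DifferentiableOn ℂ t N) (h0 : ∀ z ∈ N, t z ≠ 0) : LineBundle where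
  U₁ := ((↑) : ℂ → OnePoint ℂ) '' (Ω ∪ N)
  U₂ := insert ∞ (((↑) : ℂ → OnePoint ℂ) '' (exterior Ω ∪ N))
  isOpen₁ := OnePoint.isOpen_image_coe.2 (hΩ.union hN)
  isOpen₂ := by
    have hpre : ((↑) : ℂ → OnePoint ℂ) ⁻¹'
        (insert ∞ (((↑) : ℂ → OnePoint ℂ) '' (exterior Ω ∪ N))) = exterior Ω ∪ N := by
      ext z; simp
    have ho : IsOpen (exterior Ω ∪ N) := (isClosed_closure.isOpen_compl).union hN
    rw [OnePoint.isOpen_iff_of_mem (mem_insert _ _)]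
    rw [hpre]
    refine ⟨ho.isClosed_compl, ?_⟩
    refine Metric.isCompact_of_isClosed_isBounded ho.isClosed_compl (hb.closure.subset ?_)
    intro z hz
    by_contra h
    exact hz (Or.inl h)
  cover := by
    ext x
    induction x using OnePoint.rec with
    | infty => simp
    | coe z =>
      by_cases h1 : z ∈ Ω
      · simp [h1]
      · by_cases h2 : z ∈ closure Ω
        · have h3 : z ∈ N := hΓ (by rw [hΩ.frontier_eq]; exact ⟨h2, h1⟩)
          simp [h3]
        · simp [exterior, h2]
  t := fun x => x.elim 0 t
  holomorphic_t := by
    rintro x ⟨⟨z, hz, rfl⟩, h2⟩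
    have hzN : z ∈ N := by
      rcases hz with h | h
      · have h2' : z ∈ exterior Ω ∪ N := by simpa using h2
        exact h2'.resolve_left (fun h' => h' (subset_closure h))
      · exact h
    exact ht.analyticAt (hN.mem_nhds hzN)
  t_ne_zero := by
    rintro x ⟨⟨z, hz, rfl⟩, h2⟩
    have hzN : z ∈ N := by
      rcases hz with h | h
      · have h2' : z ∈ exterior Ω ∪ N := by simpa using h2
        exact h2'.resolve_left (fun h' => h' (subset_closure h))
      · exact h
    exact h0 z hzN

/-- The part of the domain `V` of `S` on which `1 / (S z - conj w)` is finite. It is a neighbourhood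
of `∂Ω` when `w ∉ ∂Ω`. -/
def collar (V : Set ℂ) (S : ℂ → ℂ) (w : ℂ) : Set ℂ := {z | z ∈ V ∧ S z ≠ conj w}

/-- The line bundle `λ_w` with transition function `1 / (S z - conj w)`. -/
def lambdaBundle {Ω V : Set ℂ} {γ : ℝ → ℂ} {S : ℂ → ℂ} (hΩ : IsAnalyticDomain Ω γ)
    (hS : IsSchwarzFunction Ω V S) {w : ℂ} (hw : w ∉ frontier Ω) : LineBundle :=
  glue Ω (collar V S w) (fun z => 1 / (S z - conj w)) hΩ.isOpen hΩ.isBounded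
    (hS.holomorphic.continuousOn.isOpen_inter_preimage hS.isOpen isOpen_compl_singleton)
    (fun z hz => ⟨hS.frontier_subset hz, fun h => hw (by
      rw [hS.eq_conj z hz] at h
      exact (star_injective h) ▸ hz)⟩)
    (fun z hz => (differentiableWithinAt_const _).div
      (((hS.holomorphic z hz.1).mono (fun _ h => h.1)).sub_const _) (sub_ne_zero.2 hz.2))
    (fun _ hz => one_div_ne_zero (sub_ne_zero.2 hz.2))

/-- The line bundle with transition function `exp S`. -/
def expBundle {Ω V : Set ℂ} {γ : ℝ → ℂ} {S : ℂ → ℂ} (hΩ : IsAnalyticDomain Ω γ)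
    (hS : IsSchwarzFunction Ω V S) : LineBundle :=
  glue Ω V (fun z => Complex.exp (S z)) hΩ.isOpen hΩ.isBounded hS.isOpen hS.frontier_subset
    hS.holomorphic.cexp (fun _ _ => Complex.exp_ne_zero _)

/-! ### Cauchy and exponential transforms -/

/-- The double Cauchy transform
`C_Ω(z,w) = (1/2πi) ∫_Ω dζ ∧ dζ̄ / ((ζ - z)(ζ̄ - w̄))`, where `dζ ∧ dζ̄ = -2i dA`. -/
def doubleCauchy (Ω : Set ℂ) (z w : ℂ) : ℂ :=
  (1 / (2 * Real.pi * Complex.I)) *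
    ((-2 * Complex.I) * ∫ ζ in Ω, 1 / ((ζ - z) * (conj ζ - conj w)))

open Classical in
/-- The exponential transform `E_Ω(z,w) = exp C_Ω(z,w)`. The integral diverges only if `z = w`, where
the integrand of `C_Ω` is a negative function (with respect to `dA`); then `C_Ω = -∞` and
`E_Ω = 0`. -/
def expTransform (Ω : Set ℂ) (z w : ℂ) : ℂ :=
  if IntegrableOn (fun ζ : ℂ => 1 / ((ζ - z) * (conj ζ - conj w))) Ω
  then Complex.exp (doubleCauchy Ω z w) else 0

/-- `F(z,w)` for `z, w ∈ Ωᵉ`. -/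
def pieceF (Ω : Set ℂ) (z w : ℂ) : ℂ := expTransform Ω z w

/-- `G(z,w)` for `z ∈ Ω`, `w ∈ Ωᵉ`. -/
def pieceG (Ω : Set ℂ) (z w : ℂ) : ℂ := expTransform Ω z w / (conj z - conj w)

/-- `G*(z,w)` for `z ∈ Ωᵉ`, `w ∈ Ω`. -/
def pieceGstar (Ω : Set ℂ) (z w : ℂ) : ℂ := conj (pieceG Ω w z)

/-- `H(z,w)` for `z, w ∈ Ω`: the quotient `E_Ω(z,w) / |z - w|²`, extended by continuity to
`z = w`. -/
def pieceH (Ω : Set ℂ) (z w : ℂ) : ℂ :=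
  if z = w then limUnder (𝓝[≠] w) (fun u : ℂ => expTransform Ω u w / ((‖u - w‖ : ℂ) ^ 2))
  else expTransform Ω z w / ((‖z - w‖ : ℂ) ^ 2)

/-- The Cauchy transform `C_Ω(z) = (1/2πi) ∫_Ω dζ ∧ dζ̄ / (ζ - z)`. -/
def cauchyTransform (Ω : Set ℂ) (z : ℂ) : ℂ :=
  (1 / (2 * Real.pi * Complex.I)) * ((-2 * Complex.I) * ∫ ζ in Ω, 1 / (ζ - z))

/-- The Cauchy transform of the exterior domain, `(1/2πi) ∮ ζ̄ dζ / (ζ - z)` along the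
parametrization `γ` of `∂Ω`. -/
def exteriorCauchy (γ : ℝ → ℂ) (z : ℂ) : ℂ :=
  (1 / (2 * Real.pi * Complex.I)) *
    ∫ s in (0 : ℝ)..(2 * Real.pi), conj (γ s) / (γ s - z) * deriv γ s

end SchwarzBundle

end

/-! For fixed `w`, the double Cauchy transform is the Cauchy potential `u` of the density `1 / conj
(ζ - w)` on `Ω`, i.e. a solution of `∂u/∂z̄ = 1_Ω / conj (z - w)` vanishing at infinity.

Let `w` be exterior. The density is bounded, so `u` is continuous on the whole plane and holomorphic
on the exterior. Inside `Ω` it is locally a holomorphic function plus `conj (log (z - w))`. Hence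
`exp u` is holomorphic outside and `exp u / conj (z - w)` is holomorphic inside. On the boundary
`conj z = S z`, so the two functions match there up to the factor `1 / (S z - conj w)`. Using this
relation to continue each function across the curve gives continuous functions holomorphic off the
curve. An analytic arc is removable for such functions (straighten it and apply Morera), so they
form a section. It has no zeros in the finite plane, so the quotient of any competitor by it is
entire with limit one at infinity; Liouville gives uniqueness.

For `w ∈ Ω` the density has a pole. A disc of radius `r` about `w` is removed: its contribution is
explicit, `-2 log (r / |z - w|)` inside the disc and zero outside, and the division by `|z - w|²` in
`H` cancels the resulting zero (`pieceH_eq`). The same gluing then applies. Hermitian symmetry of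
the exponential transform interchanges the variables.

The bundle `exp S` is treated in the same way with density `1_Ω`. The inner component appears as
`exp (conj z - C_Ω z)`, and `exteriorCauchy_eq` identifies the exponent with the boundary integral.
The limits follow from `conj w * C_Ω(z,w) → -C_Ω(z)` and `conj w * log (1 - s / conj w) → -s`.

The equation for `u` is never used in distributional form: `cauchyPotential_ball_conj` computes the
potential of an antiholomorphic density on a disc exactly, which suffices because holomorphy is
local. The gluing is `GluingData.isUniqueSection`, and removability is
`differentiableOn_of_off_frontier`. -/

namespace SchwarzBundle

/-! ### Cauchy transforms of bounded densities -/

/-- A bounded measurable function on the plane vanishing outside a bounded set. -/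
structure IsDensity (g : ℂ → ℂ) : Prop where
  measurable : Measurable g
  bounded : ∃ M, ∀ ζ, ‖g ζ‖ ≤ M
  support : ∃ R, ∀ ζ, R < ‖ζ‖ → g ζ = 0

/-- The solution `(1/π) ∫ g ζ / (z - ζ) dA` of `∂u/∂z̄ = g`. -/
noncomputable def cauchyPotential (g : ℂ → ℂ) (z : ℂ) : ℂ :=
  (Real.pi : ℂ)⁻¹ * ∫ ζ, g ζ * (z - ζ)⁻¹

theorem locallyIntegrable_inv : LocallyIntegrable (fun ζ : ℂ => ζ⁻¹) := by
  refine locallyIntegrable_of_norm_le_rpow (C := 1) (α := 1) (by simp) (by simp) ?_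
    measurable_inv.aestronglyMeasurable
  filter_upwards with x
  simp [Real.rpow_neg_one]

theorem integrableOn_inv_sub (z : ℂ) {K : Set ℂ} (hK : Bornology.IsBounded K) :
    IntegrableOn (fun ζ : ℂ => (z - ζ)⁻¹) K := by
  obtain ⟨R, hR⟩ := hK.subset_closedBall z
  refine IntegrableOn.mono_set ?_ hR
  rw [← integrable_indicator_iff Metric.isClosed_closedBall.measurableSet]
  have h : Integrable ((Metric.closedBall (0 : ℂ) R).indicator fun ζ => ζ⁻¹) :=
    (integrable_indicator_iff Metric.isClosed_closedBall.measurableSet).2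
      (locallyIntegrable_inv.integrableOn_isCompact (isCompact_closedBall _ _))
  refine (h.comp_sub_left z).congr (Eventually.of_forall fun ζ => ?_)
  simp only [indicator, Metric.mem_closedBall, dist_comm ζ z, dist_eq_norm, sub_zero]

namespace IsDensity

variable {g g₁ g₂ : ℂ → ℂ}

theorem exists_bounds (hg : IsDensity g) :
    ∃ M R : ℝ, 0 < M ∧ 0 < R ∧ (∀ ζ, ‖g ζ‖ ≤ M) ∧ ∀ ζ, g ζ ≠ 0 → ζ ∈ Metric.closedBall 0 R := by
  obtain ⟨M, hM⟩ := hg.bounded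
  obtain ⟨R, hR⟩ := hg.support
  refine ⟨max M 1, max R 1, by positivity, by positivity, fun ζ => (hM ζ).trans (le_max_left _ _),
    fun ζ h => ?_⟩
  by_contra h'
  rw [mem_closedBall_zero_iff, not_le] at h'
  exact h (hR ζ ((le_max_left _ _).trans_lt h'))

theorem indicator (hg : IsDensity g) {K : Set ℂ} (hK : MeasurableSet K) :
    IsDensity (K.indicator g) := by
  obtain ⟨M, hM⟩ := hg.bounded
  obtain ⟨R, hR⟩ := hg.support
  refine ⟨hg.measurable.indicator hK, ⟨M, fun ζ => (norm_indicator_le_norm_self _ _).trans (hM ζ)⟩,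
    ⟨R, fun ζ hζ => ?_⟩⟩
  simp [Set.indicator, hR ζ hζ]

theorem of_bounded_set {f : ℂ → ℂ} {K : Set ℂ} {M : ℝ} (hf : Measurable f) (hK : MeasurableSet K)
    (hb : Bornology.IsBounded K) (hM : ∀ ζ ∈ K, ‖f ζ‖ ≤ M) : IsDensity (K.indicator f) := by
  obtain ⟨R, hR⟩ := hb.subset_closedBall 0
  refine ⟨hf.indicator hK, ⟨max M 0, fun ζ => ?_⟩, ⟨R, fun ζ hζ => ?_⟩⟩
  · by_cases h : ζ ∈ K
    · simpa [h] using Or.inl (hM ζ h)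
    · simp [h]
  · refine indicator_of_notMem (fun h => ?_) _
    exact absurd (mem_closedBall_zero_iff.1 (hR h)) (not_le.2 hζ)

theorem integrable (hg : IsDensity g) : Integrable g := by
  obtain ⟨M, R, -, -, hM, hR⟩ := hg.exists_bounds
  have : IntegrableOn g (Metric.closedBall 0 R) :=
    Measure.integrableOn_of_bounded (M := M) (measure_closedBall_lt_top (x := (0 : ℂ))).ne
      hg.measurable.aestronglyMeasurable (Eventually.of_forall hM)
  exact (integrableOn_iff_integrable_of_support_subset fun ζ hζ => hR ζ hζ).1 this

theorem integrable_mul_inv (hg : IsDensity g) (z : ℂ) :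
    Integrable (fun ζ => g ζ * (z - ζ)⁻¹) := by
  obtain ⟨M, R, -, -, hM, hR⟩ := hg.exists_bounds
  have : IntegrableOn (fun ζ => g ζ * (z - ζ)⁻¹) (Metric.closedBall 0 R) :=
    (integrableOn_inv_sub z Metric.isBounded_closedBall).bdd_mul
      hg.measurable.aestronglyMeasurable (c := M) (Eventually.of_forall hM)
  refine (integrableOn_iff_integrable_of_support_subset fun ζ hζ => hR ζ ?_).1 this
  exact left_ne_zero_of_mul hζ

theorem cauchyPotential_add (h₁ : IsDensity g₁) (h₂ : IsDensity g₂) (z : ℂ) :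
    cauchyPotential (g₁ + g₂) z = cauchyPotential g₁ z + cauchyPotential g₂ z := by
  simp only [cauchyPotential, Pi.add_apply, add_mul]
  rw [integral_add (h₁.integrable_mul_inv z) (h₂.integrable_mul_inv z), mul_add]

/-- Approximating `k` in `L¹` by a continuous compactly supported `k'` changes the convolution by at
most `M ‖k - k'‖₁`, uniformly in `z`; for `k'` continuity follows by domination. -/
theorem continuous_integral_mul_comp_sub (hg : IsDensity g) {k : ℂ → ℂ} (hk : Integrable k) :
    Continuous fun z => ∫ ζ, g ζ * k (z - ζ) := by
  obtain ⟨M, R, hM0, -, hM, hR⟩ := hg.exists_bounds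
  have hint : ∀ {k : ℂ → ℂ}, Integrable k → ∀ z, Integrable fun ζ => g ζ * k (z - ζ) :=
    fun hk z => (hk.comp_sub_left z).bdd_mul hg.measurable.aestronglyMeasurable (c := M)
      (Eventually.of_forall hM)
  refine continuous_of_uniform_approx_of_continuous fun u hu => ?_
  obtain ⟨ε, hε, hεu⟩ := Metric.mem_uniformity_dist.1 hu
  obtain ⟨k', hk'c, hk'ε, hk', hk'i⟩ :=
    hk.exists_hasCompactSupport_integral_sub_le (ε := ε / (2 * M)) (by positivity)
  obtain ⟨B, hB⟩ := hk'c.exists_bound_of_continuous hk'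
  refine ⟨fun z => ∫ ζ, g ζ * k' (z - ζ), ?_, fun z => hεu ?_⟩
  · refine continuous_of_dominated (bound := fun ζ => ‖g ζ‖ * B) (fun z => (hint hk'i z).1)
      (fun z => Eventually.of_forall fun ζ => ?_) (hg.integrable.norm.mul_const B)
      (Eventually.of_forall fun ζ => by fun_prop)
    rw [norm_mul]
    exact mul_le_mul_of_nonneg_left (hB _) (norm_nonneg _)
  · rw [dist_eq_norm, ← integral_sub (hint hk z) (hint hk'i z)]
    have h2 : Integrable fun ζ => M * ‖k (z - ζ) - k' (z - ζ)‖ :=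
      (((hk.sub hk'i).norm).comp_sub_left z).const_mul M
    calc ‖∫ ζ, g ζ * k (z - ζ) - g ζ * k' (z - ζ)‖
        ≤ ∫ ζ, M * ‖k (z - ζ) - k' (z - ζ)‖ := by
          refine norm_integral_le_of_norm_le h2 (Eventually.of_forall fun ζ => ?_)
          rw [← mul_sub, norm_mul]
          exact mul_le_mul_of_nonneg_right (hM ζ) (norm_nonneg _)
      _ = M * ∫ ζ, ‖k ζ - k' ζ‖ := by
          rw [integral_const_mul, integral_sub_left_eq_self (fun ζ => ‖k ζ - k' ζ‖) volume z]
      _ ≤ M * (ε / (2 * M)) := mul_le_mul_of_nonneg_left hk'ε hM0.le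
      _ < ε := by field_simp; linarith

theorem continuous_cauchyPotential (hg : IsDensity g) : Continuous (cauchyPotential g) := by
  obtain ⟨M, R, hM0, -, hM, hR⟩ := hg.exists_bounds
  rw [continuous_iff_continuousAt]
  intro z₀
  -- `1 / ζ` is not integrable on the plane. For `|z - z₀| < 1` and `ζ` in the support, `|z - ζ| ≤ R
  -- + |z₀| + 1`, so truncating the kernel there leaves the potential unchanged near `z₀`.
  have hK : Integrable ((Metric.closedBall (0 : ℂ) (R + ‖z₀‖ + 1)).indicator fun ζ => ζ⁻¹) :=
    (integrable_indicator_iff Metric.isClosed_closedBall.measurableSet).2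
      (locallyIntegrable_inv.integrableOn_isCompact (isCompact_closedBall _ _))
  refine ContinuousAt.congr (((hg.continuous_integral_mul_comp_sub hK).const_smul
    (Real.pi : ℂ)⁻¹).continuousAt) ?_
  filter_upwards [Metric.ball_mem_nhds z₀ one_pos] with z hz
  refine congrArg ((Real.pi : ℂ)⁻¹ * ·) (integral_congr_ae (Eventually.of_forall fun ζ => ?_))
  dsimp only
  by_cases h : g ζ = 0
  · simp [h]
  · rw [indicator_of_mem]
    have h1 := mem_closedBall_zero_iff.1 (hR ζ h)
    have h2 : ‖z - z₀‖ < 1 := by simpa [dist_eq_norm] using hz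
    have h3 : ‖z - ζ‖ ≤ ‖z - z₀‖ + ‖z₀‖ + ‖ζ‖ := by
      calc ‖z - ζ‖ = ‖(z - z₀) + z₀ - ζ‖ := by ring_nf
        _ ≤ _ := (norm_sub_le _ _).trans (by gcongr; exact norm_add_le _ _)
    rw [mem_closedBall_zero_iff]; linarith

theorem differentiableAt_cauchyPotential (hg : IsDensity g) {z₀ : ℂ} (h0 : ∀ᶠ ζ in 𝓝 z₀, g ζ = 0) :
    DifferentiableAt ℂ (cauchyPotential g) z₀ := by
  obtain ⟨r, hr, hr0⟩ := Metric.eventually_nhds_iff_ball.1 h0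
  have hd := hasDerivAt_integral_of_dominated_loc_of_deriv_le (μ := volume)
    (F := fun z ζ => g ζ * (z - ζ)⁻¹) (F' := fun z ζ => g ζ * (-1 / (z - ζ) ^ 2)) (x₀ := z₀)
    (s := Metric.ball z₀ (r / 2)) (bound := fun ζ => ‖g ζ‖ * (1 / (r / 2) ^ 2))
    (Metric.ball_mem_nhds _ (by positivity))
    (Eventually.of_forall fun z => (hg.integrable_mul_inv z).1)
    (hg.integrable_mul_inv z₀) ?_ ?_ (hg.integrable.norm.mul_const _) ?_
  · exact (hd.2.const_mul _).differentiableAt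
  · exact (hg.measurable.mul (by fun_prop)).aestronglyMeasurable
  · refine Eventually.of_forall fun ζ z hz => ?_
    by_cases h : g ζ = 0
    · simp [h]
    have h1 : r ≤ dist ζ z₀ := by
      by_contra h'
      exact h (hr0 ζ (not_le.1 h'))
    have h2 : r / 2 ≤ ‖z - ζ‖ := by
      rw [← dist_eq_norm]
      have := dist_triangle_left ζ z₀ z
      have := Metric.mem_ball.1 hz
      linarith
    rw [norm_mul, norm_div, norm_neg, norm_one, norm_pow]
    gcongr
  · refine Eventually.of_forall fun ζ z hz => ?_
    by_cases h : g ζ = 0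
    · simpa [h] using hasDerivAt_const z (0 : ℂ)
    have h1 : r ≤ dist ζ z₀ := by
      by_contra h'
      exact h (hr0 ζ (not_le.1 h'))
    have h2 : z - ζ ≠ 0 := by
      intro h'
      rw [sub_eq_zero] at h'
      subst h'
      have := Metric.mem_ball.1 hz
      linarith
    simpa using (((hasDerivAt_id z).sub_const ζ).inv h2).const_mul (g ζ)

theorem isBigO_cauchyPotential (hg : IsDensity g) :
    cauchyPotential g =O[Bornology.cobounded ℂ] fun z => z⁻¹ := by
  obtain ⟨M, R, -, hR0, hM, hR⟩ := hg.exists_bounds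
  refine IsBigO.of_bound (‖(Real.pi : ℂ)⁻¹‖ * (2 * ∫ ζ, ‖g ζ‖)) ?_
  have hc : ∀ᶠ z : ℂ in Bornology.cobounded ℂ, 2 * R ≤ ‖z‖ :=
    tendsto_norm_cobounded_atTop.eventually_ge_atTop _
  filter_upwards [hc] with z hz
  have hz0 : 0 < ‖z‖ := by linarith
  rw [cauchyPotential, norm_mul, mul_assoc]
  gcongr
  rw [mul_right_comm, mul_comm (2 * _), ← integral_mul_const]
  refine norm_integral_le_of_norm_le (hg.integrable.norm.mul_const _)
    (Eventually.of_forall fun ζ => ?_)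
  by_cases h : g ζ = 0
  · simp [h]
  have h1 := mem_closedBall_zero_iff.1 (hR ζ h)
  have h2 : ‖z‖ / 2 ≤ ‖z - ζ‖ := by
    have := norm_sub_norm_le z ζ
    linarith
  rw [norm_mul, norm_inv, norm_inv]
  gcongr
  calc ‖z - ζ‖⁻¹ ≤ (‖z‖ / 2)⁻¹ := by gcongr
    _ = 2 * ‖z‖⁻¹ := by rw [inv_div]; rfl

end IsDensity

/-! ### Explicit Cauchy transforms of discs -/

/-- Integrability in polar coordinates, which Fubini requires before a plane integral can be sliced
into circles. -/
theorem integrableOn_polarCoord_symm {f : ℂ → ℂ} (hm : Measurable f) (hf : Integrable f) :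
    IntegrableOn (fun p : ℝ × ℝ => p.1 • f (Complex.polarCoord.symm p)) polarCoord.target := by
  have hms : Measurable fun p : ℝ × ℝ => f (Complex.polarCoord.symm p) :=
    hm.comp (by
      simp_rw [funext Complex.polarCoord_symm_apply]
      fun_prop)
  refine ⟨(measurable_fst.smul hms).aestronglyMeasurable, ?_⟩
  have h := Complex.lintegral_comp_polarCoord_symm (fun z => ‖f z‖ₑ)
  refine lt_of_eq_of_lt ?_ (h.le.trans_lt hf.2)
  refine setLIntegral_congr_fun polarCoord.open_target.measurableSet fun p hp => ?_
  have hp1 : 0 < p.1 := hp.1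
  simp only [enorm_smul, smul_eq_mul, Real.enorm_of_nonneg hp1.le]

theorem integral_eq_integral_circleMap {f : ℂ → ℂ} (hm : Measurable f) (hf : Integrable f) (a : ℂ) :
    ∫ ζ, f ζ = ∫ ρ in Ioi (0 : ℝ), (ρ : ℂ) *
      ∫ θ in (0 : ℝ)..2 * Real.pi, f (circleMap a ρ θ) := by
  rw [← integral_add_left_eq_self f a, ← Complex.integral_comp_polarCoord_symm]
  have hi := integrableOn_polarCoord_symm (f := fun z => f (a + z))
    (hm.comp (measurable_const_add a)) (hf.comp_add_left a)
  rw [polarCoord_target] at hi ⊢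
  rw [Measure.volume_eq_prod, setIntegral_prod _ hi]
  refine setIntegral_congr_fun measurableSet_Ioi fun ρ _ => ?_
  simp only [Complex.real_smul]
  rw [integral_const_mul]
  congr 1
  have hcm : ∀ θ : ℝ, a + Complex.polarCoord.symm (ρ, θ) = circleMap a ρ θ := by
    intro θ
    rw [Complex.polarCoord_symm_apply, circleMap, Complex.exp_mul_I]
    simp
  simp only [hcm]
  rw [← integral_Ioc_eq_integral_Ioo, ← intervalIntegral.integral_of_le (by linarith [Real.pi_pos])]
  have hp : Function.Periodic (fun θ => f (circleMap a ρ θ)) (2 * Real.pi) :=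
    (periodic_circleMap a ρ).comp f
  have := hp.intervalIntegral_add_eq (-Real.pi) 0
  rw [show -Real.pi + 2 * Real.pi = Real.pi by ring, zero_add] at this
  exact this

theorem conj_intervalIntegral (f : ℝ → ℂ) (a b : ℝ) :
    conj (∫ θ in a..b, f θ) = ∫ θ in a..b, conj (f θ) := by
  simp only [intervalIntegral, map_sub, integral_conj]

/-- On the circle, `conj (ζ - a) = ρ² / (ζ - a)`. Conjugating therefore turns the antiholomorphic
integrand into a holomorphic one, whose pole is the reflection `a + ρ² / conj (z - a)` of `z`. -/
theorem integral_conj_mul_inv_eq_circleIntegral (h : ℂ → ℂ) {a z : ℂ} {ρ : ℝ} (hρ : 0 < ρ) :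
    ∫ θ in (0 : ℝ)..2 * Real.pi, conj (h (circleMap a ρ θ)) * (z - circleMap a ρ θ)⁻¹ =
      conj (∮ ζ in C(a, ρ), Complex.I⁻¹ * (h ζ * (conj (z - a) * (ζ - a) - ρ ^ 2)⁻¹)) := by
  rw [circleIntegral, conj_intervalIntegral]
  refine intervalIntegral.integral_congr fun θ _ => ?_
  simp only [deriv_circleMap, smul_eq_mul]
  set c := circleMap 0 ρ θ with hc
  have hca : circleMap a ρ θ = a + c := by simp [hc, circleMap]
  have hc0 : c ≠ 0 := by simp [hc, hρ.ne']
  have hcc : conj c * c = (ρ : ℂ) ^ 2 := by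
    rw [mul_comm, Complex.mul_conj, Complex.normSq_eq_norm_sq, hc]; simp
  have hcc' : c * conj c = (ρ : ℂ) ^ 2 := by rw [mul_comm, hcc]
  rw [hca]
  simp only [map_mul, map_inv₀, map_sub, Complex.conj_conj, add_sub_cancel_left, map_pow,
    Complex.conj_ofReal]
  rw [← hcc, show (z - a) * conj c - conj c * c = conj c * (z - (a + c)) by ring, mul_inv]
  have hc1 : conj c ≠ 0 := by simpa using hc0
  have hI : conj Complex.I ≠ 0 := by simp
  field_simp

/-- Here `z` is outside the circle, so its reflection is inside and Cauchy's formula evaluates `h`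
at it. -/
theorem integral_conj_mul_inv_of_lt {h : ℂ → ℂ} {a z : ℂ} {ρ r : ℝ} (hρ : 0 < ρ) (hρr : ρ < r)
    (hh : DifferentiableOn ℂ h (Metric.ball a r)) (hz : ρ < ‖z - a‖) :
    ∫ θ in (0 : ℝ)..2 * Real.pi, conj (h (circleMap a ρ θ)) * (z - circleMap a ρ θ)⁻¹ =
      2 * Real.pi * conj (h (a + ρ ^ 2 / conj (z - a)) / conj (z - a)) := by
  rw [integral_conj_mul_inv_eq_circleIntegral h hρ]
  have hz0 : conj (z - a) ≠ 0 := by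
    rw [Ne, map_eq_zero, ← norm_eq_zero]; linarith
  set ω := a + ρ ^ 2 / conj (z - a) with hω
  have hωb : ω ∈ Metric.ball a ρ := by
    rw [Metric.mem_ball, dist_eq_norm, hω, add_sub_cancel_left, norm_div, norm_pow,
      Complex.norm_conj, Complex.norm_real, Real.norm_of_nonneg hρ.le, div_lt_iff₀ (by linarith)]
    nlinarith
  have hcl : DifferentiableOn ℂ h (Metric.closedBall a ρ) :=
    hh.mono (Metric.closedBall_subset_ball hρr)
  have hC := hcl.circleIntegral_sub_inv_smul hωb
  have : ∀ ζ, Complex.I⁻¹ * (h ζ * (conj (z - a) * (ζ - a) - (ρ : ℂ) ^ 2)⁻¹) =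
      (Complex.I⁻¹ * (conj (z - a))⁻¹) • ((ζ - ω)⁻¹ • h ζ) := by
    intro ζ
    rw [show conj (z - a) * (ζ - a) - (ρ : ℂ) ^ 2 = conj (z - a) * (ζ - ω) by
      rw [hω]; field_simp; ring, mul_inv]
    simp only [smul_eq_mul]; ring
  simp only [this, circleIntegral.integral_smul, hC]
  simp only [smul_eq_mul, map_mul, map_div₀, map_inv₀, Complex.conj_ofReal, map_ofNat]
  have hI : conj Complex.I ≠ 0 := by simp
  field_simp

/-- Here `z` is inside the circle, so the reflected pole is outside (or absent, if `z = a`) and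
Cauchy's theorem gives zero. -/
theorem integral_conj_mul_inv_of_gt {h : ℂ → ℂ} {a z : ℂ} {ρ r : ℝ} (hρ : 0 < ρ) (hρr : ρ < r)
    (hh : DifferentiableOn ℂ h (Metric.ball a r)) (hz : ‖z - a‖ < ρ) :
    ∫ θ in (0 : ℝ)..2 * Real.pi, conj (h (circleMap a ρ θ)) * (z - circleMap a ρ θ)⁻¹ = 0 := by
  rw [integral_conj_mul_inv_eq_circleIntegral h hρ]
  have hd : DifferentiableOn ℂ
      (fun ζ => Complex.I⁻¹ * (h ζ * (conj (z - a) * (ζ - a) - (ρ : ℂ) ^ 2)⁻¹))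
      (Metric.closedBall a ρ) := by
    intro ζ hζ
    have hne : conj (z - a) * (ζ - a) - (ρ : ℂ) ^ 2 ≠ 0 := by
      intro h0
      rw [sub_eq_zero] at h0
      have h1 := congrArg norm h0
      rw [norm_mul, Complex.norm_conj, norm_pow, Complex.norm_real, Real.norm_of_nonneg hρ.le] at h1
      have h2 : ‖ζ - a‖ ≤ ρ := by simpa [dist_eq_norm] using hζ
      nlinarith [norm_nonneg (z - a), norm_nonneg (ζ - a)]
    refine DifferentiableWithinAt.const_mul (DifferentiableWithinAt.mul
      (hh.mono (Metric.closedBall_subset_ball hρr) ζ hζ) ?_) _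
    exact DifferentiableWithinAt.inv (by fun_prop) hne
  rw [(hd.mono Metric.closure_ball_subset_closedBall).diffContOnCl.circleIntegral_eq_zero hρ.le,
    map_zero]

/-- Slicing into circles about `a`, only radii `ρ < |z - a|` contribute. Each contributes, up to `π`
and conjugation, the `ρ`-derivative of `P` at the reflection of `z`. That point runs from `a` to `z`
as `ρ` grows to `|z - a|`, so the fundamental theorem of calculus gives the value. -/
theorem cauchyPotential_ball_conj {h P : ℂ → ℂ} {a z : ℂ} {r : ℝ}
    (hP : ∀ ζ ∈ Metric.ball a r, HasDerivAt P (h ζ) ζ)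
    (hg : IsDensity ((Metric.ball a r).indicator fun ζ => conj (h ζ)))
    (hz : z ∈ Metric.ball a r) :
    cauchyPotential ((Metric.ball a r).indicator fun ζ => conj (h ζ)) z = conj (P z - P a) := by
  have hh : DifferentiableOn ℂ h (Metric.ball a r) :=
    Complex.IsExactOn.differentiableOn Metric.isOpen_ball ⟨P, hP⟩
  have hzr : ‖z - a‖ < r := by simpa [dist_eq_norm] using hz
  set R := ‖z - a‖ with hR
  have hball : ∀ {ρ : ℝ}, 0 < ρ → ∀ θ, (circleMap a ρ θ ∈ Metric.ball a r ↔ ρ < r) := by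
    intro ρ hρ θ
    simp [Metric.mem_ball, dist_eq_norm, circleMap, abs_of_pos hρ]
  rw [cauchyPotential, integral_eq_integral_circleMap
    (f := fun ζ => (Metric.ball a r).indicator (fun ζ => conj (h ζ)) ζ * (z - ζ)⁻¹)
    (hg.measurable.mul (by fun_prop)) (hg.integrable_mul_inv z) a]
  have key : ∀ ρ ∈ Ioi (0 : ℝ), ρ ≠ R → (ρ : ℂ) * ∫ θ in (0 : ℝ)..2 * Real.pi,
      (Metric.ball a r).indicator (fun ζ => conj (h ζ)) (circleMap a ρ θ) *
        (z - circleMap a ρ θ)⁻¹ = (Ioo 0 R).indicator (fun ρ : ℝ =>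
      Real.pi * conj (h (a + ρ ^ 2 / conj (z - a)) * (2 * ρ / conj (z - a)))) ρ := by
    intro ρ hρ hρR
    have hρ0 : 0 < ρ := hρ
    by_cases hρr : ρ < r
    · simp only [indicator_of_mem ((hball hρ0 _).2 hρr)]
      rcases lt_or_gt_of_ne hρR with hlt | hgt
      · rw [integral_conj_mul_inv_of_lt hρ0 hρr hh hlt,
          indicator_of_mem (show ρ ∈ Ioo 0 R from ⟨hρ0, hlt⟩)]
        simp only [map_mul, map_div₀, Complex.conj_ofReal, map_ofNat]
        ring
      · rw [integral_conj_mul_inv_of_gt hρ0 hρr hh hgt,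
          indicator_of_notMem (fun h => absurd h.2 (not_lt.2 hgt.le)), mul_zero]
    · simp only [indicator_of_notMem (fun h => hρr ((hball hρ0 _).1 h))]
      rw [indicator_of_notMem (fun h => hρr (h.2.trans hzr))]
      simp
  have hae : ∀ᵐ ρ ∂(volume.restrict (Ioi (0 : ℝ))), ρ ≠ R :=
    ae_restrict_of_ae (Measure.ae_ne volume R)
  rw [integral_congr_ae (g := (Ioo 0 R).indicator (fun ρ : ℝ =>
      Real.pi * conj (h (a + ρ ^ 2 / conj (z - a)) * (2 * ρ / conj (z - a)))))
      (by filter_upwards [hae, ae_restrict_mem measurableSet_Ioi] with ρ h1 h2 using key ρ h2 h1),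
    setIntegral_indicator measurableSet_Ioo, inter_eq_self_of_subset_right Ioo_subset_Ioi_self,
    ← integral_Ioc_eq_integral_Ioo, ← intervalIntegral.integral_of_le (norm_nonneg _),
    intervalIntegral.integral_const_mul, ← conj_intervalIntegral, ← mul_assoc,
    inv_mul_cancel₀ (by exact_mod_cast Real.pi_ne_zero), one_mul]
  congr 1
  rcases eq_or_ne z a with rfl | hza
  · simp
  have hz0 : conj (z - a) ≠ 0 := (map_ne_zero _).2 (sub_ne_zero.2 hza)
  have hR0 : 0 < R := norm_pos_iff.2 (sub_ne_zero.2 hza)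
  have hmem : ∀ ρ ∈ Icc 0 R, a + (ρ : ℂ) ^ 2 / conj (z - a) ∈ Metric.ball a r := by
    intro ρ hρ
    rw [Metric.mem_ball, dist_eq_norm, add_sub_cancel_left, norm_div, norm_pow,
      Complex.norm_conj, Complex.norm_real, Real.norm_of_nonneg hρ.1, ← hR, div_lt_iff₀ hR0]
    nlinarith [hρ.1, hρ.2]
  have hder : ∀ ρ ∈ uIcc 0 R, HasDerivAt (fun ρ : ℝ => P (a + (ρ : ℂ) ^ 2 / conj (z - a)))
      (h (a + (ρ : ℂ) ^ 2 / conj (z - a)) * (2 * ρ / conj (z - a))) ρ := by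
    intro ρ hρ
    rw [uIcc_of_le hR0.le] at hρ
    have h1 : HasDerivAt (fun x : ℂ => a + x ^ 2 / conj (z - a)) (2 * ρ / conj (z - a)) (ρ : ℂ) := by
      simpa using (((hasDerivAt_id (ρ : ℂ)).pow 2).div_const (conj (z - a))).const_add a
    exact ((hP _ (hmem ρ hρ)).comp (ρ : ℂ) h1).comp_ofReal
  have hcont : ContinuousOn (fun ρ : ℝ => h (a + (ρ : ℂ) ^ 2 / conj (z - a)) *
      (2 * ρ / conj (z - a))) (uIcc 0 R) := by
    rw [uIcc_of_le hR0.le]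
    refine ContinuousOn.mul (hh.continuousOn.comp (by fun_prop) hmem) (by fun_prop)
  rw [intervalIntegral.integral_eq_sub_of_hasDerivAt hder hcont.intervalIntegrable]
  -- A point lying on the circle is its own reflection.
  have : a + (R : ℂ) ^ 2 / conj (z - a) = z := by
    have : (R : ℂ) ^ 2 = (z - a) * conj (z - a) := by
      rw [Complex.mul_conj, Complex.normSq_eq_norm_sq, hR]; simp
    rw [this, mul_div_cancel_right₀ _ hz0]; ring
  rw [this]
  simp

/-- From `|z - w| ≤ |z - ζ| + |w - ζ|`, the product of the two reciprocals is at most their sum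
divided by `|z - w|`, and each reciprocal is locally integrable. -/
theorem integrableOn_inv_mul_inv {K : Set ℂ} (hK : Bornology.IsBounded K) {z w : ℂ} (hzw : z ≠ w) :
    IntegrableOn (fun ζ : ℂ => (conj (ζ - w))⁻¹ * (z - ζ)⁻¹) K := by
  have h1 := ((integrableOn_inv_sub z hK).norm.add (integrableOn_inv_sub w hK).norm).const_mul
    (‖z - w‖⁻¹)
  refine Integrable.mono' h1 (by fun_prop) (Eventually.of_forall fun ζ => ?_)
  rw [norm_mul, norm_inv, norm_inv, Complex.norm_conj]
  simp only [Pi.add_apply, norm_inv]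
  rw [norm_sub_rev ζ w]
  rcases eq_or_ne w ζ with rfl | h1
  · simp; positivity
  rcases eq_or_ne z ζ with rfl | h2
  · simp; positivity
  have p1 : 0 < ‖w - ζ‖ := norm_pos_iff.2 (sub_ne_zero.2 h1)
  have p2 : 0 < ‖z - ζ‖ := norm_pos_iff.2 (sub_ne_zero.2 h2)
  have p3 : 0 < ‖z - w‖ := norm_pos_iff.2 (sub_ne_zero.2 hzw)
  have h3 : ‖z - w‖ ≤ ‖z - ζ‖ + ‖w - ζ‖ := by
    have := norm_sub_le (z - ζ) (w - ζ)
    simpa using this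
  rw [← sub_nonneg]
  have : ‖z - w‖⁻¹ * (‖z - ζ‖⁻¹ + ‖w - ζ‖⁻¹) - ‖w - ζ‖⁻¹ * ‖z - ζ‖⁻¹ =
    (‖z - ζ‖ + ‖w - ζ‖ - ‖z - w‖) / (‖z - w‖ * ‖z - ζ‖ * ‖w - ζ‖) := by field_simp; ring
  rw [this]
  exact div_nonneg (by linarith) (by positivity)

/-- On the circle `dθ / conj (ζ - w)` is a constant multiple of `dζ`, so this is the integral of `1
/ (ζ - z)`: nonzero exactly when `z` is enclosed. -/
theorem integral_conj_inv_mul_inv_circleMap {w z : ℂ} {ρ : ℝ} (hρ : 0 < ρ) (hz : ‖z - w‖ ≠ ρ) :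
    ∫ θ in (0 : ℝ)..2 * Real.pi, (conj (circleMap w ρ θ - w))⁻¹ * (z - circleMap w ρ θ)⁻¹ =
      if ‖z - w‖ < ρ then -(2 * (Real.pi : ℂ) / (ρ : ℂ) ^ 2) else 0 := by
  have hρ' : (ρ : ℂ) ≠ 0 := by exact_mod_cast hρ.ne'
  have h1 : ∫ θ in (0 : ℝ)..2 * Real.pi, (conj (circleMap w ρ θ - w))⁻¹ * (z - circleMap w ρ θ)⁻¹ =
      -(Complex.I * ρ ^ 2)⁻¹ * ∮ ζ in C(w, ρ), (ζ - z)⁻¹ := by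
    rw [circleIntegral, ← intervalIntegral.integral_const_mul]
    refine intervalIntegral.integral_congr fun θ _ => ?_
    simp only [deriv_circleMap, smul_eq_mul]
    set c := circleMap 0 ρ θ with hc
    have hca : circleMap w ρ θ = w + c := by simp [hc, circleMap]
    have hc0 : c ≠ 0 := by simp [hc, hρ.ne']
    have hcc : conj c * c = (ρ : ℂ) ^ 2 := by
      rw [mul_comm, Complex.mul_conj, Complex.normSq_eq_norm_sq, hc]; simp
    have hc1 : conj c ≠ 0 := by simpa using hc0
    rw [hca, add_sub_cancel_left, ← hcc, ← neg_sub (w + c) z, inv_neg]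
    have := Complex.I_ne_zero
    field_simp
  rw [h1]
  split_ifs with h
  · rw [circleIntegral.integral_sub_inv_of_mem_ball (by simpa [dist_eq_norm] using h)]
    have := Complex.I_ne_zero
    field_simp
  · have hd : DifferentiableOn ℂ (fun ζ => (ζ - z)⁻¹) (Metric.closedBall w ρ) := by
      intro ζ hζ
      refine DifferentiableWithinAt.inv (by fun_prop) (fun h0 => ?_)
      rw [sub_eq_zero] at h0
      rw [h0, Metric.mem_closedBall, dist_eq_norm] at hζ
      exact h (lt_of_le_of_ne hζ hz)
    rw [(hd.mono Metric.closure_ball_subset_closedBall).diffContOnCl.circleIntegral_eq_zero hρ.le,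
      mul_zero]

/-- Only circles of radius `|z - w| < ρ < r` contribute, each `-2π / ρ`; this is the source of the
logarithm. -/
theorem integral_ball_conj_inv_mul_inv {w z : ℂ} {r : ℝ} (hzw : z ≠ w) :
    ∫ ζ in Metric.ball w r, (conj (ζ - w))⁻¹ * (z - ζ)⁻¹ =
      if ‖z - w‖ < r then ((-(2 * Real.pi * Real.log (r / ‖z - w‖)) : ℝ) : ℂ) else 0 := by
  set R := ‖z - w‖ with hR
  have hR0 : 0 < R := norm_pos_iff.2 (sub_ne_zero.2 hzw)
  have hm : Measurable ((Metric.ball w r).indicator fun ζ => (conj (ζ - w))⁻¹ * (z - ζ)⁻¹) :=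
    Measurable.indicator (by fun_prop) Metric.isOpen_ball.measurableSet
  have hball : ∀ {ρ : ℝ}, 0 < ρ → ∀ θ, (circleMap w ρ θ ∈ Metric.ball w r ↔ ρ < r) := by
    intro ρ hρ θ
    simp [Metric.mem_ball, dist_eq_norm, circleMap, abs_of_pos hρ]
  rw [← integral_indicator Metric.isOpen_ball.measurableSet, integral_eq_integral_circleMap hm
    ((integrable_indicator_iff Metric.isOpen_ball.measurableSet).2
      (integrableOn_inv_mul_inv Metric.isBounded_ball hzw)) w]
  have key : ∀ ρ ∈ Ioi (0 : ℝ), ρ ≠ R → (ρ : ℂ) * ∫ θ in (0 : ℝ)..2 * Real.pi,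
      (Metric.ball w r).indicator (fun ζ => (conj (ζ - w))⁻¹ * (z - ζ)⁻¹) (circleMap w ρ θ) =
      (Ioo R r).indicator (fun ρ : ℝ => ((-(2 * Real.pi) * ρ⁻¹ : ℝ) : ℂ)) ρ := by
    intro ρ hρ hρR
    have hρ0 : 0 < ρ := hρ
    have hρ' : (ρ : ℂ) ≠ 0 := by exact_mod_cast hρ0.ne'
    by_cases hρr : ρ < r
    · simp only [indicator_of_mem ((hball hρ0 _).2 hρr)]
      rw [integral_conj_inv_mul_inv_circleMap hρ0 (Ne.symm hρR)]
      by_cases hlt : R < ρ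
      · rw [if_pos hlt, indicator_of_mem (show ρ ∈ Ioo R r from ⟨hlt, hρr⟩)]
        push_cast
        field_simp
      · rw [if_neg hlt, indicator_of_notMem (fun h => hlt h.1), mul_zero]
    · simp only [indicator_of_notMem (fun h => hρr ((hball hρ0 _).1 h))]
      rw [indicator_of_notMem (fun h => hρr h.2)]
      simp
  have hae : ∀ᵐ ρ ∂(volume.restrict (Ioi (0 : ℝ))), ρ ≠ R :=
    ae_restrict_of_ae (Measure.ae_ne volume R)
  rw [integral_congr_ae (g := (Ioo R r).indicator (fun ρ : ℝ => ((-(2 * Real.pi) * ρ⁻¹ : ℝ) : ℂ)))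
      (by filter_upwards [hae, ae_restrict_mem measurableSet_Ioi] with ρ h1 h2 using key ρ h2 h1),
    setIntegral_indicator measurableSet_Ioo, inter_eq_self_of_subset_right
      (show Ioo R r ⊆ Ioi 0 from fun x hx => hR0.trans hx.1)]
  split_ifs with h
  · rw [← integral_Ioc_eq_integral_Ioo, ← intervalIntegral.integral_of_le h.le,
      intervalIntegral.integral_ofReal, intervalIntegral.integral_const_mul,
      integral_inv_of_pos hR0 (hR0.trans h)]
    push_cast; ring
  · rw [Ioo_eq_empty h]; simp

/-- The substitute for `∂u/∂z̄ = g`: the part of `g` in the disc has the explicit potential `conj (P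
z - P z₀)`, and the rest vanishes near `z₀`, so its potential is holomorphic there. -/
theorem IsDensity.differentiableAt_cauchyPotential_sub_conj {g h P : ℂ → ℂ} (hg : IsDensity g)
    {z₀ : ℂ} {r : ℝ} (hr : 0 < r) (hP : ∀ ζ ∈ Metric.ball z₀ r, HasDerivAt P (h ζ) ζ)
    (hgh : ∀ ζ ∈ Metric.ball z₀ r, g ζ = conj (h ζ)) :
    DifferentiableAt ℂ (fun z => cauchyPotential g z - conj (P z)) z₀ := by
  have hB : MeasurableSet (Metric.ball z₀ r) := Metric.isOpen_ball.measurableSet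
  have h1 := hg.indicator hB
  have h2 := hg.indicator hB.compl
  have hsum : g = (Metric.ball z₀ r).indicator g + (Metric.ball z₀ r)ᶜ.indicator g :=
    (indicator_self_add_compl _ _).symm
  have hin : (Metric.ball z₀ r).indicator g =
      (Metric.ball z₀ r).indicator fun ζ => conj (h ζ) := indicator_congr hgh
  have hd := h2.differentiableAt_cauchyPotential (z₀ := z₀) (by
    filter_upwards [Metric.ball_mem_nhds z₀ hr] with ζ hζ
    simp [hζ])
  refine (hd.sub_const (conj (P z₀))).congr_of_eventuallyEq ?_
  filter_upwards [Metric.ball_mem_nhds z₀ hr] with z hz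
  rw [hsum, h1.cauchyPotential_add h2, ← hsum, hin, cauchyPotential_ball_conj hP (hin ▸ h1) hz,
    map_sub]
  ring

/-! ### The boundary curve -/

namespace IsAnalyticDomain

variable {Ω : Set ℂ} {γ : ℝ → ℂ}

theorem continuous (hΩ : IsAnalyticDomain Ω γ) : Continuous γ :=
  hΩ.analytic.continuous

theorem hasStrictDerivAt (hΩ : IsAnalyticDomain Ω γ) (s : ℝ) :
    HasStrictDerivAt γ (deriv γ s) s :=
  (hΩ.analytic s (mem_univ s)).hasStrictDerivAt

theorem hasDerivAt (hΩ : IsAnalyticDomain Ω γ) (s : ℝ) : HasDerivAt γ (deriv γ s) s :=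
  (hΩ.hasStrictDerivAt s).hasDerivAt

theorem analytic_deriv (hΩ : IsAnalyticDomain Ω γ) : AnalyticOnNhd ℝ (deriv γ) univ :=
  hΩ.analytic.deriv

theorem continuous_deriv (hΩ : IsAnalyticDomain Ω γ) : Continuous (deriv γ) :=
  hΩ.analytic_deriv.continuous

theorem periodic_deriv (hΩ : IsAnalyticDomain Ω γ) : Function.Periodic (deriv γ) (2 * Real.pi) := by
  intro s
  rw [← deriv_comp_add_const]
  congr 1
  exact funext hΩ.periodic

theorem frontier_disjoint (hΩ : IsAnalyticDomain Ω γ) {z : ℂ} (hz : z ∈ frontier Ω) : z ∉ Ω := by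
  rw [hΩ.isOpen.frontier_eq] at hz
  exact hz.2

theorem mem_or_mem_exterior (hΩ : IsAnalyticDomain Ω γ) {z : ℂ} (hz : z ∉ range γ) :
    z ∈ Ω ∨ z ∈ exterior Ω := by
  rw [hΩ.range_eq, hΩ.isOpen.frontier_eq] at hz
  by_cases h : z ∈ Ω
  · exact Or.inl h
  · exact Or.inr fun h' => hz ⟨h', h⟩

theorem eq_of_abs_sub_lt (hΩ : IsAnalyticDomain Ω γ) {s t : ℝ} (h : γ s = γ t)
    (hst : |s - t| < 2 * Real.pi) : s = t := by
  have hp : (0 : ℝ) < 2 * Real.pi := by positivity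
  have hs : ∀ s, γ (toIcoMod hp 0 s) = γ s := fun s => by
    rw [toIcoMod]
    exact hΩ.periodic.sub_zsmul_eq _
  have hm : ∀ s, toIcoMod hp 0 s ∈ Ico 0 (2 * Real.pi) := fun s => by
    simpa using toIcoMod_mem_Ico hp 0 s
  have he := hΩ.injOn (hm s) (hm t) (by rw [hs, hs, h])
  obtain ⟨n, hn⟩ := (toIcoMod_eq_toIcoMod hp).1 he
  have hn0 : n = 0 := by
    rw [abs_sub_comm, hn, zsmul_eq_mul, abs_mul, abs_of_pos hp] at hst
    have h1 : |(n : ℝ)| < 1 := by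
      by_contra h'
      nlinarith [not_lt.1 h']
    exact Int.abs_lt_one_iff.1 (by exact_mod_cast h1)
  rw [hn0, zero_smul] at hn
  linarith

/-- The curve points whose parameter, within one period about `s₀`, is at distance at least `δ` from
`s₀` form a compact set; by simplicity of the curve it misses `γ s₀`. -/
theorem eventually_exists_param (hΩ : IsAnalyticDomain Ω γ) (s₀ : ℝ) {δ : ℝ} (hδ : 0 < δ) :
    ∀ᶠ z in 𝓝 (γ s₀), z ∈ range γ → ∃ t, |t - s₀| < δ ∧ γ t = z := by
  have hπ := Real.pi_pos
  set K : Set ℝ := Icc (s₀ - Real.pi) (s₀ + Real.pi) ∩ {t | δ ≤ |t - s₀|} with hKdef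
  have hK : IsCompact K := isCompact_Icc.inter_right
    (isClosed_le continuous_const (by fun_prop))
  have hK' := (hK.image hΩ.continuous).isClosed
  have hmem : γ s₀ ∉ γ '' K := by
    rintro ⟨t, ⟨ht1, ht2⟩, hts⟩
    have : t = s₀ := hΩ.eq_of_abs_sub_lt hts (by
      rw [abs_lt]; constructor <;> linarith [ht1.1, ht1.2])
    simp only [mem_ofPred_eq, this, sub_self, abs_zero] at ht2
    linarith
  filter_upwards [hK'.isOpen_compl.mem_nhds hmem] with z hz hzγ
  obtain ⟨t, rfl⟩ := hzγ
  obtain ⟨t', ht', hγ⟩ := hΩ.periodic.exists_mem_Ico (by positivity) t (s₀ - Real.pi)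
  refine ⟨t', ?_, hγ.symm⟩
  by_contra h
  refine hz ⟨t', ⟨⟨ht'.1, by linarith [ht'.2]⟩, not_lt.1 h⟩, hγ.symm⟩

/-- The displacement of the boundary curve in the normal direction. -/
noncomputable def _root_.SchwarzBundle.displaced (γ : ℝ → ℂ) (p : ℝ × ℝ) : ℂ :=
  γ p.2 + p.1 * Complex.I * deriv γ p.2

theorem continuous_displaced (hΩ : IsAnalyticDomain Ω γ) : Continuous (displaced γ) := by
  have h1 := hΩ.continuous
  have h2 := hΩ.continuous_deriv
  unfold displaced
  fun_prop

/-- If the displaced point were `γ t`, then with `u = t - s` strict differentiability would make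
`(iε - u) γ'(s₀)` small compared with `|ε| + |u|`. This is impossible because `|iε - u|` is at least
both `|ε|` and `|u|`. -/
theorem eventually_displaced_notMem (hΩ : IsAnalyticDomain Ω γ) (s₀ : ℝ) :
    ∀ᶠ p in 𝓝 ((0 : ℝ), s₀), p.1 ≠ 0 → displaced γ p ∉ range γ := by
  -- The errors total at most `c (|u| + |ε|) ≤ 2c |iε - u|`, while the left side is `4c |iε - u|`.
  set c := ‖deriv γ s₀‖ / 4 with hc
  have hc0 : 0 < c := by
    have := norm_pos_iff.2 (hΩ.deriv_ne_zero s₀)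
    positivity
  have hstrict := (hΩ.hasStrictDerivAt s₀).hasStrictFDerivAt.isLittleO.def hc0
  obtain ⟨δ, hδ, hδ'⟩ := Metric.eventually_nhds_iff.1 hstrict
  have hcont : Tendsto (displaced γ) (𝓝 ((0 : ℝ), s₀)) (𝓝 (γ s₀)) := by
    simpa [displaced] using hΩ.continuous_displaced.tendsto ((0 : ℝ), s₀)
  have e1 := hcont.eventually (hΩ.eventually_exists_param s₀ hδ)
  have e2 : ∀ᶠ p : ℝ × ℝ in 𝓝 ((0 : ℝ), s₀), |p.2 - s₀| < δ :=
    (continuous_snd.tendsto ((0 : ℝ), s₀)).eventually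
      (p := fun t => |t - s₀| < δ) (Metric.ball_mem_nhds s₀ hδ)
  have e3 : ∀ᶠ p : ℝ × ℝ in 𝓝 ((0 : ℝ), s₀), ‖deriv γ p.2 - deriv γ s₀‖ < c := by
    have : Tendsto (fun p : ℝ × ℝ => deriv γ p.2) (𝓝 ((0 : ℝ), s₀)) (𝓝 (deriv γ s₀)) :=
      (hΩ.continuous_deriv.comp continuous_snd).tendsto ((0 : ℝ), s₀)
    simpa [dist_eq_norm] using this.eventually (Metric.ball_mem_nhds _ hc0)
  filter_upwards [e1, e2, e3] with p h1 h2 h3 hp hmem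
  obtain ⟨t, ht, htp⟩ := h1 hmem
  have hb := hδ' (y := (t, p.2)) (by
    rw [Prod.dist_eq]; exact max_lt (by simpa [Real.dist_eq] using ht)
      (by simpa [Real.dist_eq] using h2))
  simp only [Real.norm_eq_abs, ContinuousLinearMap.toSpanSingleton_apply] at hb
  set d := deriv γ s₀ with hd
  set u : ℝ := t - p.2 with hu
  have hsplit : (p.1 * Complex.I - u) * d =
      (γ t - γ p.2 - u • d) - p.1 * Complex.I * (deriv γ p.2 - d) := by
    rw [htp, displaced, Complex.real_smul]; ring
  have hn : ‖(p.1 * Complex.I - u) * d‖ ≤ c * |u| + |p.1| * c := by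
    rw [hsplit]
    refine (norm_sub_le _ _).trans (add_le_add hb ?_)
    rw [norm_mul, norm_mul, Complex.norm_I, Complex.norm_real, mul_one, Real.norm_eq_abs]
    exact mul_le_mul_of_nonneg_left h3.le (abs_nonneg _)
  have h4 : ‖d‖ = 4 * c := by rw [hc]; ring
  rw [norm_mul, h4] at hn
  have h5 : |p.1| ≤ ‖(p.1 : ℂ) * Complex.I - u‖ := by
    simpa using Complex.abs_im_le_norm ((p.1 : ℂ) * Complex.I - u)
  have h6 : |u| ≤ ‖(p.1 : ℂ) * Complex.I - u‖ := by
    simpa using Complex.abs_re_le_norm ((p.1 : ℂ) * Complex.I - u)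
  have h7 : 0 < |p.1| := abs_pos.2 hp
  nlinarith [abs_nonneg u]

theorem exists_displaced_notMem (hΩ : IsAnalyticDomain Ω γ) :
    ∃ δ > 0, ∀ p : ℝ × ℝ, p.1 ≠ 0 → |p.1| < δ → displaced γ p ∉ range γ := by
  have h := isCompact_Icc.eventually_forall_of_forall_eventually (x₀ := (0 : ℝ))
    (K := Icc 0 (0 + 2 * Real.pi)) (P := fun ε s => ε ≠ 0 → displaced γ (ε, s) ∉ range γ)
    (fun s _ => hΩ.eventually_displaced_notMem s)
  obtain ⟨δ, hδ, hδ'⟩ := Metric.eventually_nhds_iff.1 h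
  refine ⟨δ, hδ, fun p hp hpδ => ?_⟩
  have hper : Function.Periodic (fun s => displaced γ (p.1, s)) (2 * Real.pi) := fun s => by
    simp only [displaced, hΩ.periodic s, hΩ.periodic_deriv s]
  obtain ⟨t, ht, hγ⟩ := hper.exists_mem_Ico (by positivity) p.2 0
  have := hδ' (y := p.1) (by simpa [Real.dist_eq] using hpδ) t (Ico_subset_Icc_self ht) hp
  rw [← hγ] at this
  exact this

/-- In the variable `σ = s + iε` the displacement has derivative at `0` equal to multiplication by
`γ'(0) ≠ 0`, hence surjective. -/
theorem displaced_image_mem_nhds (hΩ : IsAnalyticDomain Ω γ) {U : Set (ℝ × ℝ)}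
    (hU : U ∈ 𝓝 ((0 : ℝ), (0 : ℝ))) : displaced γ '' U ∈ 𝓝 (γ 0) := by
  set q : ℂ → ℂ := fun σ => displaced γ (σ.im, σ.re) with hq
  have hre : HasStrictFDerivAt (fun σ : ℂ => σ.re) Complex.reCLM 0 :=
    Complex.reCLM.hasStrictFDerivAt
  have him : HasStrictFDerivAt (fun σ : ℂ => (σ.im : ℂ))
      (Complex.ofRealCLM.comp Complex.imCLM) 0 :=
    (Complex.ofRealCLM.comp Complex.imCLM).hasStrictFDerivAt
  have h1 := (hΩ.hasStrictDerivAt (0 : ℂ).re).hasStrictFDerivAt.comp (0 : ℂ) hre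
  have h2 := ((hΩ.analytic_deriv (0 : ℂ).re (mem_univ _)).hasStrictFDerivAt).comp (0 : ℂ) hre
  have h3 := h1.add ((him.mul_const Complex.I).mul h2)
  have hq' : HasStrictFDerivAt q _ 0 := h3
  have := hq'.map_nhds_eq_of_surj (by
    rw [eq_top_iff]
    rintro y -
    refine ⟨y / deriv γ 0, ?_⟩
    have := hΩ.deriv_ne_zero 0
    have e := Complex.re_add_im (y / deriv γ 0)
    have e' : deriv γ 0 * (y / deriv γ 0) = y := mul_div_cancel₀ _ this
    simp
    linear_combination deriv γ 0 * e + e')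
  have hq0 : q 0 = γ 0 := by simp [hq, displaced]
  rw [← hq0, ← this]
  have hV : (fun σ : ℂ => (σ.im, σ.re)) ⁻¹' U ∈ 𝓝 (0 : ℂ) :=
    (by fun_prop : Continuous fun σ : ℂ => (σ.im, σ.re)).continuousAt.preimage_mem_nhds
      (by simpa using hU)
  refine mem_of_superset (image_mem_map hV) ?_
  rintro _ ⟨σ, hσ, rfl⟩
  exact ⟨_, hσ, rfl⟩

/-- Each one-sided strip is connected and avoids the boundary, so it lies in `Ω` as soon as it meets
`Ω`. One of them does, since `γ 0` is in the closure of `Ω` and the displaced points fill a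
neighbourhood of it. -/
theorem exists_displaced_mem (hΩ : IsAnalyticDomain Ω γ) :
    ∃ δ > 0, (∀ ε ∈ Ioo 0 δ, ∀ s, displaced γ (ε, s) ∈ Ω) ∨
      (∀ ε ∈ Ioo (-δ) 0, ∀ s, displaced γ (ε, s) ∈ Ω) := by
  obtain ⟨δ, hδ, hδ'⟩ := hΩ.exists_displaced_notMem
  refine ⟨δ, hδ, ?_⟩
  have main : ∀ J : Set ℝ, IsPreconnected J → (∀ ε ∈ J, ε ≠ 0 ∧ |ε| < δ) →
      (∃ ε ∈ J, ∃ s, displaced γ (ε, s) ∈ Ω) → ∀ ε ∈ J, ∀ s, displaced γ (ε, s) ∈ Ω := by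
    intro J hJ hJδ ⟨ε₀, hε₀, s₀, hs₀⟩ ε hε s
    have hc : IsPreconnected (displaced γ '' (J ×ˢ univ)) :=
      (hJ.prod isPreconnected_univ).image _ hΩ.continuous_displaced.continuousOn
    refine hc.subset_left_of_subset_union hΩ.isOpen isClosed_closure.isOpen_compl
      (disjoint_compl_right.mono_left subset_closure) ?_
      ⟨displaced γ (ε₀, s₀), mem_image_of_mem _ (mk_mem_prod hε₀ (mem_univ _)), hs₀⟩
      (mem_image_of_mem _ (mk_mem_prod hε (mem_univ _)))
    rintro _ ⟨p, ⟨hp, -⟩, rfl⟩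
    exact hΩ.mem_or_mem_exterior (hδ' p (hJδ _ hp).1 (hJδ _ hp).2)
  have hU : {p : ℝ × ℝ | |p.1| < δ} ∈ 𝓝 ((0 : ℝ), (0 : ℝ)) :=
    (isOpen_lt (by fun_prop) continuous_const).mem_nhds (by simpa using hδ)
  have hcl : γ 0 ∈ closure Ω := frontier_subset_closure (hΩ.range_eq ▸ mem_range_self 0)
  obtain ⟨z, ⟨p, hp, rfl⟩, hz⟩ := mem_closure_iff_nhds.1 hcl _ (hΩ.displaced_image_mem_nhds hU)
  have hpδ : |p.1| < δ := hp
  rcases lt_trichotomy p.1 0 with h | h | h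
  · right
    exact main (Ioo (-δ) 0) isPreconnected_Ioo
      (fun ε hε => ⟨hε.2.ne, abs_lt.2 ⟨hε.1, by linarith [hε.2]⟩⟩)
      ⟨p.1, ⟨(abs_lt.1 hpδ).1, h⟩, p.2, hz⟩
  · exfalso
    have : displaced γ p = γ p.2 := by simp [displaced, h]
    rw [this] at hz
    exact hΩ.frontier_disjoint (hΩ.range_eq ▸ mem_range_self p.2) hz
  · left
    exact main (Ioo 0 δ) isPreconnected_Ioo
      (fun ε hε => ⟨hε.1.ne', abs_lt.2 ⟨by linarith [hε.1], hε.2⟩⟩)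
      ⟨p.1, ⟨h, (abs_lt.1 hpδ).2⟩, p.2, hz⟩

end IsAnalyticDomain

/-! ### Winding numbers about exterior points -/

/-- Near `s` the continuous logarithm is `l s` plus the principal logarithm of `c t / c s`, because
its imaginary part moves by less than `π`. -/
theorem hasDerivAt_of_exp_eq {l c : ℝ → ℂ} {c' : ℂ} {s : ℝ} (hl : ContinuousAt l s)
    (hc : HasDerivAt c c' s) (h : ∀ t, Complex.exp (l t) = c t) : HasDerivAt l (c' / c s) s := by
  have hc0 : c s ≠ 0 := h s ▸ Complex.exp_ne_zero _
  have h1 : HasDerivAt (fun t => l s + Complex.log (c t / c s)) (c' / c s) s := by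
    have := (hc.div_const (c s)).clog_real (by rw [div_self hc0]; exact Complex.one_mem_slitPlane)
    rw [div_self hc0, div_one] at this
    exact this.const_add (l s)
  refine h1.congr_of_eventuallyEq ?_
  have h2 : ∀ᶠ t in 𝓝 s, ‖l t - l s‖ < Real.pi := by
    simpa [dist_eq_norm] using hl.eventually (Metric.ball_mem_nhds (l s) Real.pi_pos)
  filter_upwards [h2] with t ht
  have h3 := abs_lt.1 ((Complex.abs_im_le_norm _).trans_lt ht)
  rw [← h t, ← h s, ← Complex.exp_sub, Complex.log_exp h3.1 h3.2.le]
  ring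

namespace IsAnalyticDomain

variable {Ω : Set ℂ} {γ : ℝ → ℂ}

theorem exists_displaced_mem_of_lt (hΩ : IsAnalyticDomain Ω γ) {η : ℝ} (hη : 0 < η) :
    ∃ ε : ℝ, |ε| < η ∧ ∀ s, displaced γ (ε, s) ∈ Ω := by
  obtain ⟨δ, hδ, h⟩ := hΩ.exists_displaced_mem
  have hm : 0 < min δ η / 2 := by positivity
  have h1 : min δ η / 2 < δ := by linarith [min_le_left δ η]
  have h2 : min δ η / 2 < η := by linarith [min_le_right δ η]
  rcases h with h | h
  · exact ⟨min δ η / 2, by rwa [abs_of_pos hm], h _ ⟨hm, h1⟩⟩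
  · exact ⟨-(min δ η / 2), by rwa [abs_neg, abs_of_pos hm], h _ ⟨by linarith, by linarith⟩⟩

/-- The domain structure prescribes the winding number only inside. For exterior `a`, simple
connectivity gives a logarithm of `z - a` on `Ω`. Evaluated along a parallel curve in `Ω` and
corrected by a principal logarithm, it yields a periodic logarithm of `γ - a`, so the integral of
its derivative over a period vanishes. -/
theorem winding_eq_zero (hΩ : IsAnalyticDomain Ω γ) {a : ℂ} (ha : a ∈ exterior Ω) :
    ∫ s in (0 : ℝ)..(2 * Real.pi), deriv γ s / (γ s - a) = 0 := by
  have haΩ : a ∉ Ω := fun h => ha (subset_closure h)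
  have haγ : a ∉ range γ := by
    rw [hΩ.range_eq]
    exact fun h => ha (frontier_subset_closure h)
  have hne : ∀ s, γ s - a ≠ 0 := fun s h => haγ ⟨s, sub_eq_zero.1 h⟩
  obtain ⟨L, hL, hLexp⟩ := Complex.exists_continuousOn_eqOn_exp_comp hΩ.simplyConnected hΩ.isOpen
    (g := fun z => z - a) (by fun_prop) (by
      rintro ⟨z, hz, hz0⟩
      exact haΩ (sub_eq_zero.1 hz0 ▸ hz))
  have hquot : Continuous fun s => deriv γ s / (γ s - a) :=
    hΩ.continuous_deriv.div (hΩ.continuous.sub continuous_const) hne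
  have hper : Function.Periodic (fun s => deriv γ s / (γ s - a)) (2 * Real.pi) := fun s => by
    simp only [hΩ.periodic s, hΩ.periodic_deriv s]
  obtain ⟨B, hB⟩ : ∃ B, ∀ s, ‖deriv γ s / (γ s - a)‖ ≤ B := by
    obtain ⟨B, hB⟩ := (isCompact_Icc (a := (0 : ℝ)) (b := 2 * Real.pi)).exists_bound_of_continuousOn
      hquot.continuousOn
    refine ⟨B, fun s => ?_⟩
    obtain ⟨t, ht, hst⟩ := hper.exists_mem_Ico₀ (by positivity) s
    rw [hst]
    exact hB t (Ico_subset_Icc_self ht)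
  have hB1 : 0 < |B| + 1 := by positivity
  obtain ⟨ε, hε, hεΩ⟩ := hΩ.exists_displaced_mem_of_lt (inv_pos.2 hB1)
  -- The quotient of `displaced - a` by `γ - a`. The bound `|ε| < 1 / (|B| + 1)` keeps it within
  -- distance one of `1`, where the principal logarithm is continuous.
  set ratio : ℝ → ℂ := fun s => 1 + ε * Complex.I * (deriv γ s / (γ s - a)) with hratio
  have hslit : ∀ s, ratio s ∈ Complex.slitPlane := by
    intro s
    refine Complex.mem_slitPlane_of_norm_lt_one ?_
    rw [norm_mul, norm_mul, Complex.norm_I, Complex.norm_real, Real.norm_eq_abs, mul_one]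
    calc |ε| * ‖deriv γ s / (γ s - a)‖ ≤ |ε| * (|B| + 1) := by
          gcongr
          exact (hB s).trans ((le_abs_self B).trans (by linarith))
      _ < (|B| + 1)⁻¹ * (|B| + 1) := by gcongr
      _ = 1 := inv_mul_cancel₀ hB1.ne'
  set l : ℝ → ℂ := fun s => L (displaced γ (ε, s)) - Complex.log (ratio s) with hl
  have hlc : Continuous l := by
    refine (hL.comp_continuous (hΩ.continuous_displaced.comp (by fun_prop)) hεΩ).sub ?_
    exact Continuous.clog (by fun_prop) hslit
  have hexp : ∀ s, Complex.exp (l s) = γ s - a := by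
    intro s
    have h1 : Complex.exp (L (displaced γ (ε, s))) = displaced γ (ε, s) - a := hLexp (hεΩ s)
    rw [hl, Complex.exp_sub, h1, Complex.exp_log (Complex.slitPlane_ne_zero (hslit s)),
      div_eq_iff (Complex.slitPlane_ne_zero (hslit s)), hratio, displaced]
    have := hne s
    field_simp
    ring
  have hder : ∀ s ∈ uIcc (0 : ℝ) (2 * Real.pi), HasDerivAt l (deriv γ s / (γ s - a)) s :=
    fun s _ => hasDerivAt_of_exp_eq hlc.continuousAt ((hΩ.hasDerivAt s).sub_const a) hexp
  rw [intervalIntegral.integral_eq_sub_of_hasDerivAt hder (hquot.intervalIntegrable _ _),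
    sub_eq_zero]
  have hp1 := hΩ.periodic 0
  have hp2 := hΩ.periodic_deriv 0
  rw [zero_add] at hp1 hp2
  simp only [hl, hratio, displaced, hp1, hp2]

/-- The curve is the image of the real axis, a null set of the plane, under the real-differentiable
map `σ ↦ γ (Re σ)`. -/
theorem volume_frontier (hΩ : IsAnalyticDomain Ω γ) : volume (frontier Ω) = 0 := by
  have h0 : volume {σ : ℂ | σ.im = 0} = 0 := by
    have := Measure.addHaar_submodule (volume : Measure ℂ) (LinearMap.ker Complex.imLm) (by
      intro h
      have : Complex.I ∈ LinearMap.ker Complex.imLm := h ▸ Submodule.mem_top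
      simp at this)
    exact this
  have hd : DifferentiableOn ℝ (fun σ : ℂ => γ σ.re) {σ : ℂ | σ.im = 0} := by
    intro σ _
    exact ((hΩ.hasDerivAt σ.re).differentiableAt.comp σ
      Complex.reCLM.differentiableAt).differentiableWithinAt
  have := addHaar_image_eq_zero_of_differentiableOn_of_addHaar_eq_zero volume hd h0
  refine measure_mono_null ?_ this
  rw [← hΩ.range_eq]
  rintro _ ⟨s, rfl⟩
  exact ⟨s, by simp, by simp⟩

end IsAnalyticDomain

/-! ### The boundary curve is removable for continuous functions -/

/-- Morera's theorem: a rectangle crossing the real axis is cut along it, and on each half Cauchy's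
theorem needs only holomorphy in the interior and continuity up to the boundary. -/
theorem differentiableOn_of_off_real {f : ℂ → ℂ} {U : Set ℂ} (hU : IsOpen U)
    (hf : ContinuousOn f U) (hd : ∀ z ∈ U, z.im ≠ 0 → DifferentiableAt ℂ f z) :
    DifferentiableOn ℂ f U := by
  refine (Complex.isConservativeOn_and_continuousOn_iff_isDifferentiableOn hU).1 ⟨?_, hf⟩
  have aux : ∀ z w : ℂ, (uIcc z.re w.re) ×ℂ (uIcc z.im w.im) ⊆ U →
      0 ∉ Ioo (min z.im w.im) (max z.im w.im) →
      Complex.wedgeIntegral z w f + Complex.wedgeIntegral w z f = 0 := by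
    intro z w hzw h0
    rw [Complex.wedgeIntegral_add_wedgeIntegral_eq]
    refine Complex.integral_boundary_rect_eq_zero_of_continuousOn_of_differentiableOn f z w
      (hf.mono hzw) fun x hx => (hd x (hzw ?_) ?_).differentiableWithinAt
    · exact ⟨Ioo_subset_Icc_self hx.1, Ioo_subset_Icc_self hx.2⟩
    · intro h
      exact h0 (h ▸ hx.2)
  intro z w hzw
  rw [← add_eq_zero_iff_eq_neg]
  have hzw' : (uIcc z.re w.re) ×ℂ (uIcc z.im w.im) ⊆ U := hzw
  by_cases h0 : 0 ∈ Ioo (min z.im w.im) (max z.im w.im)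
  swap
  · exact aux z w hzw' h0
  have h0' : (0 : ℝ) ∈ uIcc z.im w.im := Ioo_subset_Icc_self h0
  have s1 : uIcc z.im 0 ⊆ uIcc z.im w.im := uIcc_subset_uIcc left_mem_uIcc h0'
  have s2 : uIcc 0 w.im ⊆ uIcc z.im w.im := uIcc_subset_uIcc h0' right_mem_uIcc
  have a1 := aux z (w.re : ℂ) (by
      simp only [Complex.ofReal_re, Complex.ofReal_im]
      exact fun x hx => hzw' ⟨hx.1, s1 hx.2⟩)
    (by
      rw [Complex.ofReal_im]
      rintro ⟨h1, h2⟩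
      rcases le_total z.im 0 with h | h <;> simp [h] at h1 h2)
  have a2 := aux (z.re : ℂ) w (by
      simp only [Complex.ofReal_re, Complex.ofReal_im]
      exact fun x hx => hzw' ⟨hx.1, s2 hx.2⟩)
    (by
      rw [Complex.ofReal_im]
      rintro ⟨h1, h2⟩
      rcases le_total w.im 0 with h | h <;> simp [h] at h1 h2)
  rw [Complex.wedgeIntegral_add_wedgeIntegral_eq] at a1 a2 ⊢
  simp only [Complex.ofReal_re, Complex.ofReal_im] at a1 a2
  have vert : ∀ x ∈ uIcc z.re w.re, IntervalIntegrable (fun y : ℝ => f (x + y * Complex.I)) volume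
      z.im 0 ∧ IntervalIntegrable (fun y : ℝ => f (x + y * Complex.I)) volume 0 w.im := by
    intro x hx
    have hc : ContinuousOn (fun y : ℝ => f (x + y * Complex.I)) (uIcc z.im w.im) := by
      refine hf.comp (by fun_prop) fun y hy => hzw' ?_
      simpa [Complex.mem_reProdIm] using ⟨hx, hy⟩
    exact ⟨(hc.mono s1).intervalIntegrable, (hc.mono s2).intervalIntegrable⟩
  have v1 := vert w.re right_mem_uIcc
  have v2 := vert z.re left_mem_uIcc
  rw [← intervalIntegral.integral_add_adjacent_intervals v1.1 v1.2,
    ← intervalIntegral.integral_add_adjacent_intervals v2.1 v2.2]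
  simp only [smul_add] 
  linear_combination a1 + a2

/-- The real power series, read with a complex variable, keeps its coefficients and so converges on
a disc. -/
theorem exists_analyticAt_extension {c : ℝ → ℂ} {s : ℝ} (hc : AnalyticAt ℝ c s) :
    ∃ G : ℂ → ℂ, AnalyticAt ℂ G s ∧ ∀ᶠ t : ℝ in 𝓝 s, G t = c t := by
  obtain ⟨p, hp⟩ := hc
  set q : FormalMultilinearSeries ℂ ℂ ℂ :=
    fun n => ContinuousMultilinearMap.mkPiRing ℂ (Fin n) (p.coeff n) with hq
  have hr : 0 < p.radius := hp.radius_pos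
  obtain ⟨r, hr0, hrp⟩ := ENNReal.lt_iff_exists_nnreal_btwn.1 hr
  obtain ⟨C, -, hC⟩ := p.norm_mul_pow_le_of_lt_radius hrp
  have hqr : (r : ENNReal) ≤ q.radius := by
    refine q.le_radius_of_bound C fun n => ?_
    refine le_trans ?_ (hC n)
    rw [hq, ContinuousMultilinearMap.norm_mkPiRing, FormalMultilinearSeries.norm_apply_eq_norm_coef]
  have hq0 : 0 < q.radius := hr0.trans_le hqr
  have hqs := q.hasFPowerSeriesOnBall hq0
  refine ⟨fun z => q.sum (z - s), ?_, ?_⟩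
  · have := hqs.comp_sub (s : ℂ)
    rw [zero_add] at this
    exact this.analyticAt
  · filter_upwards [hp.eventually_hasSum_sub] with t ht
    rw [FormalMultilinearSeries.sum, ← ht.tsum_eq]
    refine tsum_congr fun n => ?_
    rw [hq, ContinuousMultilinearMap.mkPiRing_apply, FormalMultilinearSeries.apply_eq_pow_smul_coeff]
    simp

namespace IsAnalyticDomain

variable {Ω : Set ℂ} {γ : ℝ → ℂ}

/-- The holomorphic extension `G` of the parametrization is locally invertible and straightens the
boundary to the real axis. Removability for `f ∘ G` is then transported back by the local inverse.
-/
theorem differentiableOn_of_off_frontier (hΩ : IsAnalyticDomain Ω γ) {f : ℂ → ℂ} {U : Set ℂ}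
    (hU : IsOpen U) (hf : ContinuousOn f U)
    (hd : ∀ z ∈ U, z ∉ frontier Ω → DifferentiableAt ℂ f z) : DifferentiableOn ℂ f U := by
  intro z hz
  by_cases hzΓ : z ∉ frontier Ω
  · exact (hd z hz hzΓ).differentiableWithinAt
  rw [not_not, ← hΩ.range_eq] at hzΓ
  obtain ⟨s, rfl⟩ := hzΓ
  obtain ⟨G, hG, hGγ⟩ := exists_analyticAt_extension (hΩ.analytic s (mem_univ s))
  have hGs : G s = γ s := hGγ.self_of_nhds
  have hderiv : deriv G s = deriv γ s := by
    have h1 : HasDerivAt (fun t : ℝ => G t) (deriv G s) s := hG.differentiableAt.hasDerivAt.comp_ofReal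
    exact (h1.congr_of_eventuallyEq (hGγ.mono fun _ h => h.symm)).unique (hΩ.hasDerivAt s)
  have hne : deriv G s ≠ 0 := hderiv ▸ hΩ.deriv_ne_zero s
  have hstr := hG.hasStrictDerivAt
  have hinv := hstr.to_localInverse hne
  set g := hstr.localInverse G (deriv G s) s hne with hg
  have hleft : ∀ᶠ σ in 𝓝 (s : ℂ), g (G σ) = σ :=
    (hstr.hasStrictFDerivAt_equiv hne).eventually_left_inverse
  have hright : ∀ᶠ x in 𝓝 (G s), G (g x) = x := hstr.eventually_right_inverse hne
  have hloc : ∀ᶠ t : ℝ in 𝓝 s, G t = γ t ∧ g (G t) = t :=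
    hGγ.and (Complex.continuous_ofReal.continuousAt.eventually hleft)
  obtain ⟨δ, hδ, hδ'⟩ := Metric.eventually_nhds_iff.1 hloc
  -- A boundary point `G σ` near `γ s` is `γ t = G t` with `t` near `s`; local injectivity of `G`
  -- forces `σ = t`, which is real.
  have hoff : ∀ᶠ σ in 𝓝 (s : ℂ), σ.im ≠ 0 → G σ ∉ frontier Ω := by
    have hp := hG.continuousAt.eventually (hGs ▸ hΩ.eventually_exists_param s hδ)
    filter_upwards [hp, hleft] with σ h1 h2 hσ hmem
    obtain ⟨t, ht, htσ⟩ := h1 (hΩ.range_eq ▸ hmem)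
    obtain ⟨h3, h4⟩ := hδ' (y := t) (by rwa [Real.dist_eq])
    rw [h3, htσ, h2] at h4
    exact hσ (by rw [h4, Complex.ofReal_im])
  have hnb : ∀ᶠ σ in 𝓝 (s : ℂ), (σ.im ≠ 0 → G σ ∉ frontier Ω) ∧ G σ ∈ U ∧ AnalyticAt ℂ G σ :=
    hoff.and ((hG.continuousAt.eventually (hU.mem_nhds (hGs ▸ hz))).and hG.eventually_analyticAt)
  obtain ⟨ρ, hρ, hρ'⟩ := Metric.eventually_nhds_iff_ball.1 hnb
  have hfG : DifferentiableOn ℂ (f ∘ G) (Metric.ball (s : ℂ) ρ) := by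
    refine differentiableOn_of_off_real Metric.isOpen_ball ?_ fun σ hσ him => ?_
    · exact hf.comp (fun σ hσ => (hρ' σ hσ).2.2.continuousAt.continuousWithinAt)
        fun σ hσ => (hρ' σ hσ).2.1
    · exact (hd _ (hρ' σ hσ).2.1 ((hρ' σ hσ).1 him)).comp σ (hρ' σ hσ).2.2.differentiableAt
  have hgs : g (γ s) = s := by rw [← hGs]; exact hleft.self_of_nhds
  have hfGs : DifferentiableAt ℂ (f ∘ G) (g (γ s)) := by
    rw [hgs]
    exact hfG.differentiableAt (Metric.ball_mem_nhds _ hρ)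
  have hfin : DifferentiableAt ℂ ((f ∘ G) ∘ g) (γ s) :=
    hfGs.comp (γ s) (hGs ▸ hinv.hasDerivAt.differentiableAt)
  refine (hfin.congr_of_eventuallyEq ?_).differentiableWithinAt
  filter_upwards [hGs ▸ hright] with x hx
  simp only [Function.comp_apply, hx]

end IsAnalyticDomain

/-! ### The Cauchy–Pompeiu formula for `conj z` -/

/-- A bound independent of `p`, which justifies exchanging the curve integral with the area integral
below. -/
theorem integral_norm_inv_sub_le {R : ℝ} {p : ℂ} (hp : p ∈ Metric.ball 0 R) :
    ∫ η in Metric.ball 0 R, ‖(p - η)⁻¹‖ ≤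
      ∫ ζ, (Metric.closedBall (0 : ℂ) (2 * R)).indicator (fun ζ => ‖ζ⁻¹‖) ζ := by
  have hi : Integrable ((Metric.closedBall (0 : ℂ) (2 * R)).indicator fun ζ => ‖ζ⁻¹‖) :=
    (integrable_indicator_iff Metric.isClosed_closedBall.measurableSet).2
      (locallyIntegrable_inv.integrableOn_isCompact (isCompact_closedBall _ _)).norm
  rw [← integral_sub_left_eq_self _ volume p]
  refine le_trans (le_of_eq ?_) (setIntegral_le_integral (s := Metric.ball 0 R)
    (hi.comp_sub_left p) (Eventually.of_forall fun η => indicator_nonneg (by simp) _))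
  refine setIntegral_congr_fun Metric.isOpen_ball.measurableSet fun η hη => ?_
  rw [indicator_of_mem]
  rw [mem_closedBall_zero_iff]
  rw [mem_ball_zero_iff] at hp hη
  linarith [norm_sub_le p η]

theorem cauchyTransform_eq {Ω : Set ℂ} (hΩ : MeasurableSet Ω) (z : ℂ) :
    cauchyTransform Ω z = cauchyPotential (Ω.indicator fun _ => 1) z := by
  have h1 : ∫ ζ in Ω, 1 / (ζ - z) = -∫ ζ, Ω.indicator (fun _ => (1 : ℂ)) ζ * (z - ζ)⁻¹ := by
    rw [← integral_indicator hΩ, ← integral_neg]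
    refine integral_congr_ae (Eventually.of_forall fun ζ => ?_)
    by_cases h : ζ ∈ Ω
    · simp only [indicator_of_mem h, one_mul, one_div]
      rw [← inv_neg, neg_sub]
    · simp [indicator_of_notMem h]
  rw [cauchyTransform, h1, cauchyPotential]
  have := Complex.I_ne_zero
  have : (Real.pi : ℂ) ≠ 0 := by exact_mod_cast Real.pi_ne_zero
  field_simp

theorem isDensity_one {K : Set ℂ} (hK : MeasurableSet K) (hb : Bornology.IsBounded K) :
    IsDensity (K.indicator fun _ => 1) :=
  IsDensity.of_bounded_set (M := 1) measurable_const hK hb (by simp)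

theorem cauchyPotential_ball_one {R : ℝ} {z : ℂ} (hz : z ∈ Metric.ball 0 R) :
    cauchyPotential ((Metric.ball 0 R).indicator fun _ => 1) z = conj z := by
  have h := cauchyPotential_ball_conj (h := fun _ => 1) (P := id) (fun ζ _ => hasDerivAt_id ζ)
    (by simpa using isDensity_one Metric.isOpen_ball.measurableSet Metric.isBounded_ball) hz
  simpa using h

namespace IsAnalyticDomain

variable {Ω : Set ℂ} {γ : ℝ → ℂ}

/-- On the curve `conj ζ` is the potential of a large disc `D`. After Fubini and partial fractions,
the inner curve integral is a difference of winding numbers, proportional to `1 - 1_Ω(η)`. What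
remains is the potential of `D` at `z`, equal to `conj z`, minus that of `Ω`. -/
theorem exteriorCauchy_eq (hΩ : IsAnalyticDomain Ω γ) {z : ℂ} (hz : z ∈ Ω) :
    exteriorCauchy γ z = conj z - cauchyTransform Ω z := by
  have hπ : (Real.pi : ℂ) ≠ 0 := by exact_mod_cast Real.pi_ne_zero
  have h2π : (0 : ℝ) ≤ 2 * Real.pi := by positivity
  have hΩm := hΩ.isOpen.measurableSet
  obtain ⟨R, hR⟩ := hΩ.isBounded.closure.subset_ball 0
  set D := Metric.ball (0 : ℂ) R with hD
  have hDm : MeasurableSet D := Metric.isOpen_ball.measurableSet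
  have hγD : ∀ s, γ s ∈ D := fun s =>
    hR (frontier_subset_closure (hΩ.range_eq ▸ mem_range_self s))
  have hne : ∀ s, γ s - z ≠ 0 := fun s h =>
    hΩ.frontier_disjoint (hΩ.range_eq ▸ mem_range_self s) ((sub_eq_zero.1 h) ▸ hz)
  set k : ℝ → ℂ := fun s => deriv γ s / (γ s - z) with hk
  have hkc : Continuous k := hΩ.continuous_deriv.div (hΩ.continuous.sub continuous_const) hne
  obtain ⟨B, hB⟩ := (isCompact_Icc (a := (0 : ℝ)) (b := 2 * Real.pi)).exists_bound_of_continuousOn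
    hkc.continuousOn
  have hmeas : Measurable fun p : ℝ × ℂ => (γ p.1 - p.2)⁻¹ * k p.1 := by
    have h1 := hΩ.continuous.measurable
    have h2 := hkc.measurable
    fun_prop
  have hint : Integrable (Function.uncurry fun (s : ℝ) (η : ℂ) => (γ s - η)⁻¹ * k s)
      ((volume.restrict (Ioc 0 (2 * Real.pi))).prod (volume.restrict D)) := by
    have hm : AEStronglyMeasurable (Function.uncurry fun (s : ℝ) (η : ℂ) => (γ s - η)⁻¹ * k s)
      ((volume.restrict (Ioc 0 (2 * Real.pi))).prod (volume.restrict D)) :=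
      hmeas.aestronglyMeasurable
    rw [integrable_prod_iff hm]
    refine ⟨Eventually.of_forall fun s =>
      (integrableOn_inv_sub (γ s) Metric.isBounded_ball).mul_const (k s), ?_⟩
    refine Integrable.mono' (integrable_const
      ((∫ ζ, (Metric.closedBall (0 : ℂ) (2 * R)).indicator (fun ζ => ‖ζ⁻¹‖) ζ) * B))
      hm.norm.integral_prod_right' ?_
    filter_upwards [ae_restrict_mem measurableSet_Ioc] with s hs
    simp only [Function.uncurry_apply_pair, norm_mul]
    rw [integral_mul_const, Real.norm_of_nonneg (by positivity)]
    gcongr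
    · exact integral_nonneg fun ζ => indicator_nonneg (by simp) _
    · exact integral_norm_inv_sub_le (hγD s)
    · exact hB s (Ioc_subset_Icc_self hs)
  have hwind : ∀ η, η ∉ frontier Ω → ∫ s in (0 : ℝ)..(2 * Real.pi), deriv γ s / (γ s - η) =
      2 * Real.pi * Complex.I * Ω.indicator (fun _ => 1) η := by
    intro η hη
    rcases hΩ.mem_or_mem_exterior (hΩ.range_eq ▸ hη) with h | h
    · have := hΩ.winding η h
      rw [indicator_of_mem h]
      have hI := Complex.I_ne_zero
      field_simp at this
      rw [this]; ring
    · rw [hΩ.winding_eq_zero h, indicator_of_notMem (fun h' => h (subset_closure h'))]; simp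
  have hinner : ∀ η, η ∉ frontier Ω → η ≠ z →
      ∫ s in (0 : ℝ)..(2 * Real.pi), (γ s - η)⁻¹ * k s =
      2 * Real.pi * Complex.I * ((z - η)⁻¹ - Ω.indicator (fun _ => 1) η * (z - η)⁻¹) := by
    intro η hη hηz
    have hη' : ∀ s, γ s - η ≠ 0 := fun s h =>
      hη (hΩ.range_eq ▸ ⟨s, sub_eq_zero.1 h⟩)
    have hzη : z - η ≠ 0 := sub_ne_zero.2 hηz.symm
    have hkη : Continuous fun s => deriv γ s / (γ s - η) :=
      hΩ.continuous_deriv.div (hΩ.continuous.sub continuous_const) hη'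
    have : ∀ s, (γ s - η)⁻¹ * k s = (z - η)⁻¹ * (k s - deriv γ s / (γ s - η)) := by
      intro s
      have h1 := hη' s
      have h2 := hne s
      rw [hk]
      field_simp
      ring
    simp only [this]
    rw [intervalIntegral.integral_const_mul, intervalIntegral.integral_sub
      (hkc.intervalIntegrable _ _) (hkη.intervalIntegrable _ _), hwind η hη,
      hwind z (fun h => hΩ.frontier_disjoint h hz), indicator_of_mem hz]
    ring
  have hae : ∀ᵐ η ∂(volume.restrict D), η ∉ frontier Ω ∧ η ≠ z := by
    refine ae_restrict_of_ae ?_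
    filter_upwards [measure_eq_zero_iff_ae_notMem.1 hΩ.volume_frontier, Measure.ae_ne volume z]
      with η h1 h2 using ⟨h1, h2⟩
  have hLHS : exteriorCauchy γ z = (2 * Real.pi * Complex.I)⁻¹ * ((Real.pi : ℂ)⁻¹ *
      ∫ s in Ioc 0 (2 * Real.pi), ∫ η in D, (γ s - η)⁻¹ * k s) := by
    rw [exteriorCauchy, one_div, intervalIntegral.integral_of_le h2π]
    congr 1
    rw [← integral_const_mul]
    refine integral_congr_ae (Eventually.of_forall fun s => ?_)
    dsimp only
    rw [← cauchyPotential_ball_one (hγD s), cauchyPotential, integral_mul_const,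
      ← integral_indicator hDm, hk]
    have : ∀ η, D.indicator (fun _ => (1 : ℂ)) η * (γ s - η)⁻¹ =
        D.indicator (fun η => (γ s - η)⁻¹) η := fun η => by
      by_cases h : η ∈ D <;> simp [h]
    simp only [hD] at this ⊢
    simp only [this]
    ring
  have hΩD : ∀ η, η ∈ Ω → η ∈ D := fun η h => hR (subset_closure h)
  have hA : IntegrableOn (fun η => (z - η)⁻¹) D := integrableOn_inv_sub z Metric.isBounded_ball
  have hBi : Integrable (fun η => Ω.indicator (fun _ => (1 : ℂ)) η * (z - η)⁻¹) :=
    (isDensity_one hΩm hΩ.isBounded).integrable_mul_inv z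
  rw [hLHS, integral_integral_swap hint]
  have : ∫ η in D, ∫ s in Ioc 0 (2 * Real.pi), (γ s - η)⁻¹ * k s =
      2 * Real.pi * Complex.I * ((∫ η in D, (z - η)⁻¹) -
        ∫ η, Ω.indicator (fun _ => (1 : ℂ)) η * (z - η)⁻¹) := by
    have h3 : ∫ η, Ω.indicator (fun _ => (1 : ℂ)) η * (z - η)⁻¹ =
        ∫ η in D, Ω.indicator (fun _ => (1 : ℂ)) η * (z - η)⁻¹ := by
      refine (setIntegral_eq_integral_of_forall_compl_eq_zero fun η hη => ?_).symm
      rw [indicator_of_notMem (fun h => hη (hΩD η h)), zero_mul]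
    rw [h3, ← integral_sub hA hBi.integrableOn, ← integral_const_mul]
    refine integral_congr_ae ?_
    filter_upwards [hae] with η hη
    rw [← intervalIntegral.integral_of_le h2π, hinner η hη.1 hη.2]
  rw [this, cauchyTransform_eq hΩm, cauchyPotential,
    ← cauchyPotential_ball_one (hΩD z hz), cauchyPotential]
  have hone : ∫ η, (Metric.ball (0 : ℂ) R).indicator (fun _ => (1 : ℂ)) η * (z - η)⁻¹ =
      ∫ η in D, (z - η)⁻¹ := by
    rw [← integral_indicator hDm]
    refine integral_congr_ae (Eventually.of_forall fun η => ?_)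
    by_cases h : η ∈ Metric.ball (0 : ℂ) R <;> simp [h, hD]
  rw [hone]
  have := Complex.I_ne_zero
  field_simp

end IsAnalyticDomain

/-! ### Holomorphy at infinity -/

theorem invChart_zero : invChart 0 = ∞ := if_pos rfl

theorem invChart_of_ne {u : ℂ} (hu : u ≠ 0) : invChart u = ((u⁻¹ : ℂ) : OnePoint ℂ) := if_neg hu

/-- Removable singularity at `0` in the coordinate `1 / z`. -/
theorem holomorphicAt_infty {f : OnePoint ℂ → ℂ}
    (hd : ∀ᶠ z : ℂ in Bornology.cobounded ℂ, DifferentiableAt ℂ (fun z : ℂ => f z) z)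
    (ht : Tendsto (fun z : ℂ => f z) (Bornology.cobounded ℂ) (𝓝 (f ∞))) : HolomorphicAt f ∞ := by
  change AnalyticAt ℂ (fun u : ℂ => f (invChart u)) 0
  have heq : ∀ u : ℂ, u ≠ 0 → f (invChart u) = f ((u⁻¹ : ℂ) : OnePoint ℂ) :=
    fun u hu => by rw [invChart_of_ne hu]
  refine Complex.analyticAt_of_differentiable_on_punctured_nhds_of_continuousAt ?_ ?_
  · filter_upwards [tendsto_inv₀_nhdsNE_zero.eventually hd, self_mem_nhdsWithin] with u h1 h2
    have h3 : DifferentiableAt ℂ (fun u : ℂ => f ((u⁻¹ : ℂ) : OnePoint ℂ)) u :=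
      h1.comp u (differentiableAt_inv h2)
    refine h3.congr_of_eventuallyEq ?_
    filter_upwards [isOpen_ne.mem_nhds h2] with v hv using heq v hv
  · rw [continuousAt_iff_punctured_nhds, invChart_zero]
    refine (ht.comp tendsto_inv₀_nhdsNE_zero).congr' ?_
    filter_upwards [self_mem_nhdsWithin] with u hu using (heq u hu).symm

theorem HolomorphicAt.tendsto_cobounded {f : OnePoint ℂ → ℂ} (hf : HolomorphicAt f ∞) :
    Tendsto (fun z : ℂ => f z) (Bornology.cobounded ℂ) (𝓝 (f ∞)) := by
  have h1 : Tendsto (fun u : ℂ => f (invChart u)) (𝓝 0) (𝓝 (f (invChart 0))) :=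
    (show AnalyticAt ℂ (fun u : ℂ => f (invChart u)) 0 from hf).continuousAt
  rw [invChart_zero] at h1
  refine (h1.comp tendsto_inv₀_cobounded).congr' ?_
  filter_upwards [Bornology.eventually_ne_cobounded (0 : ℂ)] with z hz
  simp [invChart_of_ne (inv_ne_zero hz)]

theorem HolomorphicAt.differentiableAt {f : OnePoint ℂ → ℂ} {z : ℂ}
    (hf : HolomorphicAt f (z : OnePoint ℂ)) : DifferentiableAt ℂ (fun u : ℂ => f u) z :=
  (show AnalyticAt ℂ (fun u : ℂ => f u) z from hf).differentiableAt

/-! ### Sections obtained by gluing along the boundary curve -/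

open Classical in
/-- The first component of the section glued from `a` on `closure Ω` and `b` on `Ωᶜ`. -/
noncomputable def sectionFst (Ω : Set ℂ) (t a b : ℂ → ℂ) (x : OnePoint ℂ) : ℂ :=
  x.elim 0 fun z => if z ∈ closure Ω then a z else t z * b z

open Classical in
/-- The second component of the section glued from `a` on `closure Ω` and `b` on `Ωᶜ`, with
value `c` at infinity. -/
noncomputable def sectionSnd (Ω : Set ℂ) (t a b : ℂ → ℂ) (c : ℂ) (x : OnePoint ℂ) : ℂ :=
  x.elim c fun z => if z ∈ Ω then (t z)⁻¹ * a z else b z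

/-- Data on the two sides of the boundary curve that match on the curve up to the transition
function `t`. -/
structure GluingData (Ω N : Set ℂ) (t a b : ℂ → ℂ) (c : ℂ) : Prop where
  isOpen : IsOpen N
  frontier_subset : frontier Ω ⊆ N
  differentiableOn : DifferentiableOn ℂ t N
  ne_zero : ∀ z ∈ N, t z ≠ 0
  continuousOn_fst : ContinuousOn a (closure Ω)
  differentiableOn_fst : DifferentiableOn ℂ a Ω
  continuousOn_snd : ContinuousOn b Ωᶜ
  differentiableOn_snd : DifferentiableOn ℂ b (exterior Ω)
  tendsto_snd : Tendsto b (Bornology.cobounded ℂ) (𝓝 c)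
  eq_on_frontier : ∀ z ∈ frontier Ω, a z = t z * b z

section

variable {Ω N : Set ℂ} {γ : ℝ → ℂ} {t a b : ℂ → ℂ} {c : ℂ}

theorem sectionFst_of_mem {z : ℂ} (hz : z ∈ closure Ω) : sectionFst Ω t a b z = a z :=
  if_pos hz

theorem sectionFst_of_notMem {z : ℂ} (hz : z ∉ closure Ω) : sectionFst Ω t a b z = t z * b z :=
  if_neg hz

theorem sectionSnd_of_mem {z : ℂ} (hz : z ∈ Ω) : sectionSnd Ω t a b c z = (t z)⁻¹ * a z :=
  if_pos hz

theorem sectionSnd_of_notMem {z : ℂ} (hz : z ∉ Ω) : sectionSnd Ω t a b c z = b z :=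
  if_neg hz

namespace GluingData

theorem relation (hd : GluingData Ω N t a b c) {z : ℂ} (hz : z ∈ N) :
    sectionFst Ω t a b z = t z * sectionSnd Ω t a b c z := by
  by_cases h1 : z ∈ Ω
  · rw [sectionFst_of_mem (subset_closure h1), sectionSnd_of_mem h1,
      mul_inv_cancel_left₀ (hd.ne_zero z hz)]
  · rw [sectionSnd_of_notMem h1]
    by_cases h2 : z ∈ closure Ω
    · rw [sectionFst_of_mem h2, hd.eq_on_frontier z ⟨h2, fun h => h1 (interior_subset h)⟩]
    · rw [sectionFst_of_notMem h2]

/-- The closed sets `closure Ω` and `Ωᶜ` cover the plane. The function is `a` on the first and, near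
the curve, `t * b` on the second; the matching condition makes both descriptions valid on the curve
itself. -/
theorem continuousAt_fst (hd : GluingData Ω N t a b c) (hA : IsAnalyticDomain Ω γ) {z : ℂ}
    (hz : z ∈ frontier Ω) : ContinuousAt (fun u : ℂ => sectionFst Ω t a b u) z := by
  have hzN := hd.frontier_subset hz
  have hzΩ : z ∈ Ωᶜ := hA.frontier_disjoint hz
  rw [← continuousWithinAt_univ,
    show (univ : Set ℂ) = closure Ω ∪ Ωᶜ from (eq_univ_of_forall fun x =>
      (em (x ∈ Ω)).imp (fun h => subset_closure h) id).symm]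
  refine ContinuousWithinAt.union ?_ ?_
  · exact (hd.continuousOn_fst z hz.1).congr (fun u hu => sectionFst_of_mem hu)
      (sectionFst_of_mem hz.1)
  · have hcont : ContinuousWithinAt (fun u => t u * b u) Ωᶜ z :=
      ((hd.differentiableOn.continuousOn.continuousAt
        (hd.isOpen.mem_nhds hzN)).continuousWithinAt).mul (hd.continuousOn_snd z hzΩ)
    have heq : ∀ u ∈ Ωᶜ, u ∈ N → sectionFst Ω t a b u = t u * b u := fun u hu huN => by
      rw [hd.relation huN, sectionSnd_of_notMem hu]
    refine hcont.congr_of_eventuallyEq ?_ (heq z hzΩ hzN)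
    filter_upwards [self_mem_nhdsWithin, mem_nhdsWithin_of_mem_nhds (hd.isOpen.mem_nhds hzN)]
      with u h1 h2 using heq u h1 h2

theorem differentiableOn_sectionFst (hd : GluingData Ω N t a b c) (hA : IsAnalyticDomain Ω γ) :
    DifferentiableOn ℂ (fun u : ℂ => sectionFst Ω t a b u) (Ω ∪ N) := by
  have key : ∀ z ∈ Ω ∪ N, z ∉ frontier Ω →
      DifferentiableAt ℂ (fun u : ℂ => sectionFst Ω t a b u) z := by
    intro z hz hzΓ
    rcases hA.mem_or_mem_exterior (hA.range_eq ▸ hzΓ) with h | h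
    · refine (hd.differentiableOn_fst.differentiableAt (hA.isOpen.mem_nhds h)).congr_of_eventuallyEq
        ?_
      filter_upwards [hA.isOpen.mem_nhds h] with u hu using sectionFst_of_mem (subset_closure hu)
    · have hzN : z ∈ N := hz.resolve_left fun h' => h (subset_closure h')
      have ho : exterior Ω ∈ 𝓝 z := isClosed_closure.isOpen_compl.mem_nhds h
      refine ((hd.differentiableOn.differentiableAt (hd.isOpen.mem_nhds hzN)).mul
        (hd.differentiableOn_snd.differentiableAt ho)).congr_of_eventuallyEq ?_
      filter_upwards [ho] with u hu using sectionFst_of_notMem hu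
  refine hA.differentiableOn_of_off_frontier (hA.isOpen.union hd.isOpen) (fun z hz => ?_) key
  by_cases hzΓ : z ∈ frontier Ω
  · exact (hd.continuousAt_fst hA hzΓ).continuousWithinAt
  · exact (key z hz hzΓ).continuousAt.continuousWithinAt

/-- On `N` this is the first component divided by `t`, so removability need not be invoked again. -/
theorem differentiableOn_sectionSnd (hd : GluingData Ω N t a b c) (hA : IsAnalyticDomain Ω γ) :
    DifferentiableOn ℂ (fun u : ℂ => sectionSnd Ω t a b c u) (exterior Ω ∪ N) := by
  have hext : IsOpen (exterior Ω) := isClosed_closure.isOpen_compl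
  have hN : ∀ z ∈ N, DifferentiableAt ℂ (fun u : ℂ => sectionSnd Ω t a b c u) z := by
    intro z hz
    have h1 := (hd.differentiableOn_sectionFst hA).differentiableAt
      ((hA.isOpen.union hd.isOpen).mem_nhds (Or.inr hz))
    have h2 := (hd.differentiableOn.differentiableAt (hd.isOpen.mem_nhds hz)).inv (hd.ne_zero z hz)
    refine (h2.mul h1).congr_of_eventuallyEq ?_
    filter_upwards [hd.isOpen.mem_nhds hz] with u hu
    simp only [Pi.mul_apply, Pi.inv_apply]
    rw [hd.relation hu, inv_mul_cancel_left₀ (hd.ne_zero u hu)]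
  rintro z (hz | hz)
  · refine ((hd.differentiableOn_snd.differentiableAt (hext.mem_nhds hz)).congr_of_eventuallyEq
      ?_).differentiableWithinAt
    filter_upwards [hext.mem_nhds hz] with u hu
      using sectionSnd_of_notMem fun h => hu (subset_closure h)
  · exact (hN z hz).differentiableWithinAt

theorem exterior_mem_cobounded (hA : IsAnalyticDomain Ω γ) :
    exterior Ω ∈ Bornology.cobounded ℂ :=
  Bornology.isBounded_def.1 hA.isBounded.closure

theorem tendsto_sectionSnd (hd : GluingData Ω N t a b c) (hA : IsAnalyticDomain Ω γ) :
    Tendsto (fun z : ℂ => sectionSnd Ω t a b c z) (Bornology.cobounded ℂ) (𝓝 c) := by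
  refine hd.tendsto_snd.congr' ?_
  filter_upwards [exterior_mem_cobounded hA] with z hz
    using (sectionSnd_of_notMem fun h => hz (subset_closure h)).symm

variable {hΩ : IsOpen Ω} {hb : Bornology.IsBounded Ω} {hN : IsOpen N} {hΓ : frontier Ω ⊆ N}
  {ht : DifferentiableOn ℂ t N} {h0 : ∀ z ∈ N, t z ≠ 0}

theorem coe_mem_glue_fst {z : ℂ} :
    (z : OnePoint ℂ) ∈ (glue Ω N t hΩ hb hN hΓ ht h0).U₁ ↔ z ∈ Ω ∪ N := by
  simp [glue]

theorem coe_mem_glue_snd {z : ℂ} :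
    (z : OnePoint ℂ) ∈ (glue Ω N t hΩ hb hN hΓ ht h0).U₂ ↔ z ∈ exterior Ω ∪ N := by
  simp [glue]

theorem infty_notMem_glue_fst : ∞ ∉ (glue Ω N t hΩ hb hN hΓ ht h0).U₁ := by
  simp [glue]

theorem infty_mem_glue_snd : ∞ ∈ (glue Ω N t hΩ hb hN hΓ ht h0).U₂ := by
  simp [glue]

theorem coe_mem_glue_inter {z : ℂ} :
    (z : OnePoint ℂ) ∈ (glue Ω N t hΩ hb hN hΓ ht h0).U₁ ∩ (glue Ω N t hΩ hb hN hΓ ht h0).U₂ ↔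
      z ∈ N := by
  rw [mem_inter_iff, coe_mem_glue_fst, coe_mem_glue_snd]
  constructor
  · rintro ⟨h1 | h1, h2 | h2⟩
    · exact absurd (subset_closure h1) h2
    all_goals assumption
  · exact fun h => ⟨Or.inr h, Or.inr h⟩

theorem isSection (hd : GluingData Ω N t a b c) (hA : IsAnalyticDomain Ω γ) :
    (glue Ω N t hΩ hb hN hΓ ht h0).IsSection (sectionFst Ω t a b) (sectionSnd Ω t a b c) := by
  refine ⟨fun x hx => ?_, fun x hx => ?_, fun x hx => ?_⟩
  · induction x using OnePoint.rec with
    | infty => exact absurd hx infty_notMem_glue_fst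
    | coe z =>
      exact (hd.differentiableOn_sectionFst hA).analyticAt
        ((hA.isOpen.union hd.isOpen).mem_nhds (coe_mem_glue_fst.1 hx))
  · induction x using OnePoint.rec with
    | infty =>
      refine holomorphicAt_infty ?_ (hd.tendsto_sectionSnd hA)
      filter_upwards [exterior_mem_cobounded hA] with z hz
      exact (hd.differentiableOn_sectionSnd hA).differentiableAt
        ((isClosed_closure.isOpen_compl.union hd.isOpen).mem_nhds (Or.inl hz))
    | coe z =>
      exact (hd.differentiableOn_sectionSnd hA).analyticAt
        ((isClosed_closure.isOpen_compl.union hd.isOpen).mem_nhds (coe_mem_glue_snd.1 hx))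
  · induction x using OnePoint.rec with
    | infty => exact absurd hx.1 infty_notMem_glue_fst
    | coe z => exact hd.relation (coe_mem_glue_inter.1 hx)

/-- The transition function cancels in the quotient of two sections, so the quotients on the two
charts form one entire function; Liouville makes it `1`. Stating the normalization as `g₂ / b → 1`
covers both the value one and the leading term `1 / z`, where `b` vanishes at infinity. -/
theorem eq_of_tendsto (hd : GluingData Ω N t a b c) (hA : IsAnalyticDomain Ω γ)
    (ha0 : ∀ z ∈ closure Ω, a z ≠ 0) (hb0 : ∀ z ∈ Ωᶜ, b z ≠ 0) {g₁ g₂ : OnePoint ℂ → ℂ}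
    (hg : (glue Ω N t hΩ hb hN hΓ ht h0).IsSection g₁ g₂)
    (hlim : Tendsto (fun z : ℂ => g₂ z / b z) (Bornology.cobounded ℂ) (𝓝 1)) :
    EqOn g₁ (sectionFst Ω t a b) (glue Ω N t hΩ hb hN hΓ ht h0).U₁ ∧
      EqOn g₂ (sectionSnd Ω t a b c) (glue Ω N t hΩ hb hN hΓ ht h0).U₂ := by
  classical
  have hrel : ∀ z ∈ N, g₁ z = t z * g₂ z := fun z hz => hg.2.2 z (coe_mem_glue_inter.2 hz)
  set k : ℂ → ℂ := fun z => if z ∈ closure Ω then g₁ z / a z else g₂ z / b z with hk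
  have hk1 : ∀ z ∈ Ω ∪ N, k z = g₁ z / sectionFst Ω t a b z := by
    intro z hz
    by_cases h : z ∈ closure Ω
    · simp only [hk, if_pos h, sectionFst_of_mem h]
    · have hzN : z ∈ N := hz.resolve_left fun h' => h (subset_closure h')
      simp only [hk, if_neg h, sectionFst_of_notMem h]
      rw [hrel z hzN, mul_div_mul_left _ _ (hd.ne_zero z hzN)]
  have hf0 : ∀ z ∈ Ω ∪ N, sectionFst Ω t a b z ≠ 0 := by
    intro z hz
    by_cases h : z ∈ closure Ω
    · rw [sectionFst_of_mem h]; exact ha0 z h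
    · have hzN : z ∈ N := hz.resolve_left fun h' => h (subset_closure h')
      rw [sectionFst_of_notMem h]
      exact mul_ne_zero (hd.ne_zero z hzN) (hb0 z fun h' => h (subset_closure h'))
  have hext : IsOpen (exterior Ω) := isClosed_closure.isOpen_compl
  have hcov : ∀ z, z ∈ Ω ∪ N ∨ z ∈ exterior Ω := fun z => by
    by_cases h : z ∈ frontier Ω
    · exact Or.inl (Or.inr (hd.frontier_subset h))
    · exact (hA.mem_or_mem_exterior (hA.range_eq ▸ h)).imp_left Or.inl
  have hkd : Differentiable ℂ k := by
    intro z
    rcases hcov z with h | h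
    · have ho := (hA.isOpen.union hd.isOpen).mem_nhds h
      have hg1 := (hg.1 z (coe_mem_glue_fst.2 h)).differentiableAt
      refine (hg1.fun_div ((hd.differentiableOn_sectionFst hA).differentiableAt ho)
        (hf0 z h)).congr_of_eventuallyEq ?_
      filter_upwards [ho] with u hu using hk1 u hu
    · have hg2 := (hg.2.1 z (coe_mem_glue_snd.2 (Or.inl h))).differentiableAt
      refine (hg2.fun_div (hd.differentiableOn_snd.differentiableAt (hext.mem_nhds h))
        (hb0 z fun h' => h (subset_closure h'))).congr_of_eventuallyEq ?_
      filter_upwards [hext.mem_nhds h] with u hu using if_neg hu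
  have hkt : Tendsto k (cocompact ℂ) (𝓝 1) := by
    rw [← Metric.cobounded_eq_cocompact]
    refine hlim.congr' ?_
    filter_upwards [exterior_mem_cobounded hA] with z hz using (if_neg hz).symm
  have hkc : ∀ z, k z = 1 := fun z => hkd.apply_eq_of_tendsto_cocompact z hkt
  have h1 : ∀ z ∈ Ω ∪ N, g₁ z = sectionFst Ω t a b z := fun z hz => by
    have := hkc z
    rwa [hk1 z hz, div_eq_one_iff_eq (hf0 z hz)] at this
  have h2 : ∀ z ∈ exterior Ω, g₂ z = b z := fun z hz => by
    have := hkc z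
    simp only [hk, if_neg (show z ∉ closure Ω from hz)] at this
    rwa [div_eq_one_iff_eq (hb0 z fun h' => hz (subset_closure h'))] at this
  refine ⟨fun x hx => ?_, fun x hx => ?_⟩
  · induction x using OnePoint.rec with
    | infty => exact absurd hx infty_notMem_glue_fst
    | coe z => exact h1 z (coe_mem_glue_fst.1 hx)
  · induction x using OnePoint.rec with
    | infty =>
      refine tendsto_nhds_unique (hg.2.1 ∞ hx).tendsto_cobounded (hd.tendsto_snd.congr' ?_)
      filter_upwards [exterior_mem_cobounded hA] with z hz using (h2 z hz).symm
    | coe z =>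
      rcases coe_mem_glue_snd.1 hx with h | h
      · rw [h2 z h, sectionSnd_of_notMem fun h' => h (subset_closure h')]
      · have e1 := h1 z (Or.inr h)
        rw [hrel z h, hd.relation h] at e1
        exact mul_left_cancel₀ (hd.ne_zero z h) e1

theorem isUniqueSection (hd : GluingData Ω N t a b c) (hA : IsAnalyticDomain Ω γ)
    (ha0 : ∀ z ∈ closure Ω, a z ≠ 0) (hb0 : ∀ z ∈ Ωᶜ, b z ≠ 0) {P : (OnePoint ℂ → ℂ) → Prop}
    (hP : P (sectionSnd Ω t a b c))
    (hlim : ∀ g : OnePoint ℂ → ℂ, HolomorphicAt g ∞ → P g →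
      Tendsto (fun z : ℂ => g z / b z) (Bornology.cobounded ℂ) (𝓝 1)) :
    (glue Ω N t hΩ hb hN hΓ ht h0).IsUniqueSection P (sectionFst Ω t a b)
      (sectionSnd Ω t a b c) :=
  ⟨hd.isSection hA, hP, fun _ g₂ hg hPg => hd.eq_of_tendsto hA ha0 hb0 hg
    (hlim g₂ (hg.2.1 ∞ infty_mem_glue_snd) hPg)⟩

end GluingData

end

/-! ### The exponential transform as the exponential of a Cauchy potential -/

/-- The density whose Cauchy potential is the double Cauchy transform of `K`. -/
noncomputable def kernelDensity (K : Set ℂ) (w : ℂ) : ℂ → ℂ :=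
  K.indicator fun ζ => (conj (ζ - w))⁻¹

section

variable {K Ω : Set ℂ} {z w : ℂ} {r : ℝ}

theorem isDensity_kernelDensity (hK : MeasurableSet K) (hb : Bornology.IsBounded K) (hr : 0 < r)
    (hw : ∀ ζ ∈ K, r ≤ ‖ζ - w‖) : IsDensity (kernelDensity K w) := by
  refine IsDensity.of_bounded_set (M := r⁻¹) (by fun_prop) hK hb fun ζ hζ => ?_
  rw [norm_inv, Complex.norm_conj]
  gcongr
  exact hw ζ hζ

theorem kernelDensity_mul_inv (K : Set ℂ) (z w ζ : ℂ) : kernelDensity K w ζ * (z - ζ)⁻¹ =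
    K.indicator (fun ζ => (conj (ζ - w))⁻¹ * (z - ζ)⁻¹) ζ := by
  by_cases h : ζ ∈ K <;> simp [kernelDensity, h]

theorem kernel_eq (z w ζ : ℂ) :
    1 / ((ζ - z) * (conj ζ - conj w)) = -((conj (ζ - w))⁻¹ * (z - ζ)⁻¹) := by
  rw [one_div, mul_inv, map_sub, ← neg_sub z ζ, inv_neg]
  ring

theorem doubleCauchy_eq (hΩ : MeasurableSet Ω) (z w : ℂ) :
    doubleCauchy Ω z w = cauchyPotential (kernelDensity Ω w) z := by
  rw [doubleCauchy, cauchyPotential]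
  simp only [kernelDensity_mul_inv, kernel_eq]
  rw [integral_indicator hΩ, integral_neg]
  have := Complex.I_ne_zero
  have : (Real.pi : ℂ) ≠ 0 := by exact_mod_cast Real.pi_ne_zero
  field_simp

theorem expTransform_of_ne (hΩ : MeasurableSet Ω) (hb : Bornology.IsBounded Ω) (hzw : z ≠ w) :
    expTransform Ω z w = Complex.exp (cauchyPotential (kernelDensity Ω w) z) := by
  rw [expTransform, if_pos, doubleCauchy_eq hΩ]
  simp only [kernel_eq]
  exact (integrableOn_inv_mul_inv hb hzw).neg

theorem expTransform_of_isDensity (hΩ : MeasurableSet Ω) (hd : IsDensity (kernelDensity Ω w))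
    (z : ℂ) : expTransform Ω z w = Complex.exp (cauchyPotential (kernelDensity Ω w) z) := by
  rw [expTransform, if_pos, doubleCauchy_eq hΩ]
  simp only [kernel_eq]
  have := hd.integrable_mul_inv z
  simp only [kernelDensity_mul_inv] at this
  exact ((integrable_indicator_iff hΩ).1 this).neg

/-- Conjugation exchanges `z` and `w` in the kernel, hence also preserves divergence. This is what
transfers the sections to the second variable. -/
theorem conj_expTransform (Ω : Set ℂ) (z w : ℂ) :
    conj (expTransform Ω z w) = expTransform Ω w z := by
  have hker : ∀ ζ : ℂ, conj (1 / ((ζ - z) * (conj ζ - conj w))) =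
      1 / ((ζ - w) * (conj ζ - conj z)) := fun ζ => by
    simp only [map_div₀, map_one, map_mul, map_sub, Complex.conj_conj]
    rw [mul_comm]
  have hint : IntegrableOn (fun ζ : ℂ => 1 / ((ζ - z) * (conj ζ - conj w))) Ω ↔
      IntegrableOn (fun ζ : ℂ => 1 / ((ζ - w) * (conj ζ - conj z))) Ω := by
    simp only [← hker]
    exact (Complex.conjCLE.integrable_comp_iff).symm
  rw [expTransform, expTransform]
  by_cases h : IntegrableOn (fun ζ : ℂ => 1 / ((ζ - z) * (conj ζ - conj w))) Ω
  · rw [if_pos h, if_pos (hint.1 h), ← Complex.exp_conj, doubleCauchy, doubleCauchy]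
    congr 1
    simp only [map_mul, ← integral_conj, hker]
    simp
    have := Complex.I_ne_zero
    have : (Real.pi : ℂ) ≠ 0 := by exact_mod_cast Real.pi_ne_zero
    field_simp
  · rw [if_neg h, if_neg (mt hint.2 h), map_zero]

/-- The density is the conjugate of `1 / (ζ - w)`, with primitive a logarithm, so the potential is a
holomorphic function plus `conj (log (z - w))`; exponentiating and dividing removes the
antiholomorphic factor. A general `K` allows `Ω` with a disc about `w` removed. -/
theorem differentiableAt_exp_cauchyPotential_div {z₀ : ℂ} {ρ : ℝ}
    (hd : IsDensity (kernelDensity K w)) (hρ : 0 < ρ)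
    (hK : Metric.ball z₀ ρ ⊆ K) (hw : w ∉ K) :
    DifferentiableAt ℂ (fun z => Complex.exp (cauchyPotential (kernelDensity K w) z) /
      (conj z - conj w)) z₀ := by
  have hwb : ∀ ζ ∈ Metric.ball z₀ ρ, ζ - w ≠ 0 := fun ζ hζ h =>
    hw (hK (sub_eq_zero.1 h ▸ hζ))
  have hz₀ : z₀ - w ≠ 0 := hwb z₀ (Metric.mem_ball_self hρ)
  have hρw : ρ ≤ ‖z₀ - w‖ := by
    by_contra h
    refine hw (hK ?_)
    rw [Metric.mem_ball, dist_comm, dist_eq_norm]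
    exact not_le.1 h
  -- Dividing by `z₀ - w` places the values within distance one of `1`, so the principal branch
  -- serves on the whole disc.
  have hslit : ∀ ζ ∈ Metric.ball z₀ ρ, (ζ - w) / (z₀ - w) ∈ Complex.slitPlane := by
    intro ζ hζ
    have : (ζ - w) / (z₀ - w) = 1 + (ζ - z₀) / (z₀ - w) := by field_simp; ring
    rw [this]
    refine Complex.mem_slitPlane_of_norm_lt_one ?_
    rw [norm_div, div_lt_one (norm_pos_iff.2 hz₀)]
    rw [Metric.mem_ball, dist_eq_norm] at hζ
    exact hζ.trans_le hρw
  have hP : ∀ ζ ∈ Metric.ball z₀ ρ,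
      HasDerivAt (fun ζ => Complex.log ((ζ - w) / (z₀ - w))) (ζ - w)⁻¹ ζ := by
    intro ζ hζ
    have := (((hasDerivAt_id ζ).sub_const w).div_const (z₀ - w)).clog (hslit ζ hζ)
    convert this using 1
    have := hwb ζ hζ
    simp only [id]
    field_simp
    rfl
  have hdiff := hd.differentiableAt_cauchyPotential_sub_conj hρ hP fun ζ hζ => by
    rw [kernelDensity, indicator_of_mem (hK hζ), map_inv₀]
  refine (hdiff.cexp.div_const (conj (z₀ - w))).congr_of_eventuallyEq ?_
  filter_upwards [Metric.ball_mem_nhds z₀ hρ] with z hz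
  have h1 : conj (z - w) ≠ 0 := (map_ne_zero _).2 (hwb z hz)
  have h2 : conj (z₀ - w) ≠ 0 := (map_ne_zero _).2 hz₀
  rw [Complex.exp_sub, Complex.exp_conj, Complex.exp_log
    (Complex.slitPlane_ne_zero (hslit z hz)), map_div₀, ← map_sub]
  field_simp

theorem tendsto_cauchyPotential {g : ℂ → ℂ} (hg : IsDensity g) :
    Tendsto (cauchyPotential g) (Bornology.cobounded ℂ) (𝓝 0) :=
  hg.isBigO_cauchyPotential.trans_tendsto tendsto_inv₀_cobounded

theorem cauchyPotential_kernelDensity_sdiff (hΩ : MeasurableSet Ω) (hb : Bornology.IsBounded Ω)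
    (hwr : Metric.ball w r ⊆ Ω) (hzw : z ≠ w) :
    cauchyPotential (kernelDensity Ω w) z =
      cauchyPotential (kernelDensity (Ω \ Metric.ball w r) w) z +
        if ‖z - w‖ < r then ((-(2 * Real.log (r / ‖z - w‖)) : ℝ) : ℂ) else 0 := by
  have hB : MeasurableSet (Metric.ball w r) := Metric.isOpen_ball.measurableSet
  simp only [cauchyPotential, kernelDensity_mul_inv]
  have hi := integrableOn_inv_mul_inv hb hzw
  rw [integral_indicator hΩ, integral_indicator (hΩ.diff hB),
    ← integral_inter_add_sdiff hB hi, add_comm, inter_eq_self_of_subset_right hwr,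
    integral_ball_conj_inv_mul_inv hzw, mul_add]
  congr 1
  have : (Real.pi : ℂ) ≠ 0 := by exact_mod_cast Real.pi_ne_zero
  split_ifs
  · push_cast; field_simp
  · simp

/-- Inside the disc the removed part contributes the factor `|z - w|² / r²`, cancelling the
denominator; outside it contributes nothing. The maximum expresses both cases. -/
theorem expTransform_div_norm_sq (hΩ : MeasurableSet Ω) (hb : Bornology.IsBounded Ω) (hr : 0 < r)
    (hwr : Metric.ball w r ⊆ Ω) (hzw : z ≠ w) :
    expTransform Ω z w / ((‖z - w‖ : ℂ) ^ 2) =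
      Complex.exp (cauchyPotential (kernelDensity (Ω \ Metric.ball w r) w) z) /
        ((max r ‖z - w‖ : ℝ) : ℂ) ^ 2 := by
  have hz0 : 0 < ‖z - w‖ := norm_pos_iff.2 (sub_ne_zero.2 hzw)
  rw [expTransform_of_ne hΩ hb hzw, cauchyPotential_kernelDensity_sdiff hΩ hb hwr hzw,
    Complex.exp_add]
  split_ifs with h
  · have : Real.exp (-(2 * Real.log (r / ‖z - w‖))) = ‖z - w‖ ^ 2 / r ^ 2 := by
      rw [Real.exp_neg, mul_comm, Real.exp_mul, Real.exp_log (by positivity)]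
      norm_num
      rw [div_pow, inv_div]
    rw [← Complex.ofReal_exp, this, max_eq_left h.le]
    have h1 : (‖z - w‖ : ℂ) ≠ 0 := by exact_mod_cast hz0.ne'
    have h2 : (r : ℂ) ≠ 0 := by exact_mod_cast hr.ne'
    push_cast
    field_simp
  · rw [max_eq_right (not_lt.1 h), Complex.exp_zero, mul_one]

theorem expTransform_of_le (hΩ : MeasurableSet Ω) (hb : Bornology.IsBounded Ω)
    (hr : 0 < r) (hwr : Metric.ball w r ⊆ Ω) (hz : r ≤ ‖z - w‖) :
    expTransform Ω z w =
      Complex.exp (cauchyPotential (kernelDensity (Ω \ Metric.ball w r) w) z) := by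
  have hzw : z ≠ w := by
    rintro rfl
    simp at hz
    linarith
  rw [expTransform_of_ne hΩ hb hzw, cauchyPotential_kernelDensity_sdiff hΩ hb hwr hzw,
    if_neg (not_lt.2 hz), add_zero]

theorem isDensity_kernelDensity_sdiff (hΩ : MeasurableSet Ω) (hb : Bornology.IsBounded Ω)
    (hr : 0 < r) : IsDensity (kernelDensity (Ω \ Metric.ball w r) w) :=
  isDensity_kernelDensity (hΩ.diff Metric.isOpen_ball.measurableSet) (hb.subset sdiff_subset) hr
    fun ζ hζ => by simpa [dist_eq_norm] using hζ.2

/-- The right side is continuous at `z = w`, so it also gives the limit defining the diagonal value.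
Every admissible `r` gives the same function, so `r` may be chosen to suit the point. -/
theorem pieceH_eq (hΩ : MeasurableSet Ω) (hb : Bornology.IsBounded Ω) (hr : 0 < r)
    (hwr : Metric.ball w r ⊆ Ω) (z : ℂ) :
    pieceH Ω z w = Complex.exp (cauchyPotential (kernelDensity (Ω \ Metric.ball w r) w) z) /
        ((max r ‖z - w‖ : ℝ) : ℂ) ^ 2 := by
  rw [pieceH]
  split_ifs with h
  · subst h
    refine Tendsto.limUnder_eq ?_
    have hc : Continuous fun u =>
        Complex.exp (cauchyPotential (kernelDensity (Ω \ Metric.ball z r) z) u) /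
        ((max r ‖u - z‖ : ℝ) : ℂ) ^ 2 := by
      have := (isDensity_kernelDensity_sdiff (w := z) hΩ hb hr).continuous_cauchyPotential
      refine Continuous.div (by fun_prop) (by fun_prop) fun u => ?_
      have : (0 : ℝ) < max r ‖u - z‖ := lt_max_of_lt_left hr
      exact pow_ne_zero _ (by exact_mod_cast this.ne')
    refine ((hc.tendsto z).mono_left nhdsWithin_le_nhds).congr' ?_
    filter_upwards [self_mem_nhdsWithin] with u hu
    exact (expTransform_div_norm_sq hΩ hb hr hwr hu).symm
  · exact expTransform_div_norm_sq hΩ hb hr hwr h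

theorem conj_pieceH (hΩ : IsOpen Ω) (hb : Bornology.IsBounded Ω) (hw : w ∈ Ω) (z : ℂ) :
    conj (pieceH Ω z w) = pieceH Ω w z := by
  by_cases h : z = w
  · subst h
    obtain ⟨r, hr, hzr⟩ := Metric.isOpen_iff.1 hΩ z hw
    rw [pieceH_eq hΩ.measurableSet hb hr hzr, map_div₀, ← Complex.exp_conj, map_pow,
      Complex.conj_ofReal, cauchyPotential, map_mul, ← integral_conj, map_inv₀, Complex.conj_ofReal]
    -- On the diagonal the integrand is `-|ζ - z|⁻²`, which is real.
    congr 4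
    ext ζ
    simp only [kernelDensity_mul_inv]
    by_cases hζ : ζ ∈ Ω \ Metric.ball z r
    · simp only [indicator_of_mem hζ, map_mul, map_inv₀, Complex.conj_conj]
      rw [← neg_sub z ζ, map_neg, inv_neg, inv_neg]
      ring
    · simp only [indicator_of_notMem hζ, map_zero]
  · rw [pieceH, pieceH, if_neg h, if_neg (Ne.symm h), map_div₀, conj_expTransform, map_pow,
      Complex.conj_ofReal, norm_sub_rev]

end

/-! ### The sections of the bundles `λ_w` and `exp S` -/

theorem tendsto_div_of_valueOne {g : OnePoint ℂ → ℂ} {b : ℂ → ℂ} (hg : HolomorphicAt g ∞)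
    (hg1 : ValueOne g) (hb : Tendsto b (Bornology.cobounded ℂ) (𝓝 1)) :
    Tendsto (fun z : ℂ => g z / b z) (Bornology.cobounded ℂ) (𝓝 1) := by
  have h := hg.tendsto_cobounded
  rw [show g ∞ = 1 from hg1] at h
  have h1 := h.div hb one_ne_zero
  rw [div_one] at h1
  exact h1

theorem LeadingTermInv.tendsto_mul {g : OnePoint ℂ → ℂ} (hg : LeadingTermInv g) :
    Tendsto (fun z : ℂ => z * g z) (Bornology.cobounded ℂ) (𝓝 1) := by
  have h1 : (fun z : ℂ => z * (g z - 1 / z)) =O[Bornology.cobounded ℂ] fun z : ℂ => z⁻¹ := by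
    refine ((isBigO_refl (fun z : ℂ => z) _).mul hg).trans (IsBigO.of_bound 1 ?_)
    filter_upwards [Bornology.eventually_ne_cobounded (0 : ℂ)] with z hz
    rw [one_mul]
    refine le_of_eq (congrArg norm ?_)
    field_simp
  have h2 := (h1.trans_tendsto tendsto_inv₀_cobounded).add_const 1
  rw [zero_add] at h2
  refine h2.congr' ?_
  filter_upwards [Bornology.eventually_ne_cobounded (0 : ℂ)] with z hz
  field_simp
  ring

theorem tendsto_div_of_leadingTermInv {g f : OnePoint ℂ → ℂ} (hg : LeadingTermInv g)
    (hf : LeadingTermInv f) :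
    Tendsto (fun z : ℂ => g z / f z) (Bornology.cobounded ℂ) (𝓝 1) := by
  have h := hg.tendsto_mul.div hf.tendsto_mul one_ne_zero
  rw [div_one] at h
  refine h.congr' ?_
  filter_upwards [Bornology.eventually_ne_cobounded (0 : ℂ)] with z hz
  exact mul_div_mul_left _ _ hz

section

variable {Ω V : Set ℂ} {γ : ℝ → ℂ} {S : ℂ → ℂ} {w : ℂ}

theorem isOpen_collar (hS : IsSchwarzFunction Ω V S) (w : ℂ) : IsOpen (collar V S w) :=
  hS.holomorphic.continuousOn.isOpen_inter_preimage hS.isOpen isOpen_compl_singleton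

theorem frontier_subset_collar (hS : IsSchwarzFunction Ω V S) (hw : w ∉ frontier Ω) :
    frontier Ω ⊆ collar V S w := fun z hz => ⟨hS.frontier_subset hz, fun h => hw (by
  rw [hS.eq_conj z hz] at h
  exact (star_injective h) ▸ hz)⟩

theorem differentiableOn_one_div_sub (hS : IsSchwarzFunction Ω V S) (w : ℂ) :
    DifferentiableOn ℂ (fun z => 1 / (S z - conj w)) (collar V S w) := fun z hz =>
  (differentiableWithinAt_const _).div
    (((hS.holomorphic z hz.1).mono (fun _ h => h.1)).sub_const _) (sub_ne_zero.2 hz.2)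

theorem exists_le_norm_sub (hw : w ∈ exterior Ω) : ∃ r > 0, ∀ ζ ∈ Ω, r ≤ ‖ζ - w‖ := by
  obtain ⟨r, hr, h⟩ := Metric.isOpen_iff.1 isClosed_closure.isOpen_compl w hw
  refine ⟨r, hr, fun ζ hζ => ?_⟩
  by_contra h'
  exact h (by rw [Metric.mem_ball, dist_eq_norm]; exact not_le.1 h') (subset_closure hζ)

theorem isDensity_of_mem_exterior (hΩ : IsAnalyticDomain Ω γ) (hw : w ∈ exterior Ω) :
    IsDensity (kernelDensity Ω w) := by
  obtain ⟨r, hr, h⟩ := exists_le_norm_sub hw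
  exact isDensity_kernelDensity hΩ.isOpen.measurableSet hΩ.isBounded hr h

theorem tendsto_exp_cauchyPotential {g : ℂ → ℂ} (hg : IsDensity g) :
    Tendsto (fun z => Complex.exp (cauchyPotential g z)) (Bornology.cobounded ℂ) (𝓝 1) := by
  simpa using (tendsto_cauchyPotential hg).cexp

theorem differentiableOn_cauchyPotential_exterior {g : ℂ → ℂ} (hg : IsDensity g)
    (h0 : ∀ ζ ∉ Ω, g ζ = 0) : DifferentiableOn ℂ (cauchyPotential g) (exterior Ω) := fun z hz =>
  (hg.differentiableAt_cauchyPotential (by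
    filter_upwards [isClosed_closure.isOpen_compl.mem_nhds hz] with ζ hζ
      using h0 ζ fun h => hζ (subset_closure h))).differentiableWithinAt

/-- The two components differ only by the factor `conj z - conj w`, which is `S z - conj w` on the
boundary. -/
theorem gluingData_exterior (hΩ : IsAnalyticDomain Ω γ) (hS : IsSchwarzFunction Ω V S)
    (hw : w ∈ exterior Ω) :
    GluingData Ω (collar V S w) (fun z => 1 / (S z - conj w))
      (fun z => Complex.exp (cauchyPotential (kernelDensity Ω w) z) / (conj z - conj w))
      (fun z => Complex.exp (cauchyPotential (kernelDensity Ω w) z)) 1 := by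
  have hd := isDensity_of_mem_exterior hΩ hw
  have hc := hd.continuous_cauchyPotential
  have hne : ∀ z ∈ closure Ω, conj z - conj w ≠ 0 := fun z hz h =>
    hw (star_injective (sub_eq_zero.1 h) ▸ hz)
  exact {
    isOpen := isOpen_collar hS w
    frontier_subset := frontier_subset_collar hS fun h => hw (frontier_subset_closure h)
    differentiableOn := differentiableOn_one_div_sub hS w
    ne_zero := fun z hz => one_div_ne_zero (sub_ne_zero.2 hz.2)
    continuousOn_fst := ContinuousOn.div (by fun_prop) (by fun_prop) hne
    differentiableOn_fst := fun z hz => by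
      obtain ⟨ρ, hρ, hball⟩ := Metric.isOpen_iff.1 hΩ.isOpen z hz
      exact (differentiableAt_exp_cauchyPotential_div hd hρ hball
        fun h => hw (subset_closure h)).differentiableWithinAt
    continuousOn_snd := by fun_prop
    differentiableOn_snd := (differentiableOn_cauchyPotential_exterior hd
      fun ζ hζ => indicator_of_notMem hζ _).cexp
    tendsto_snd := tendsto_exp_cauchyPotential hd
    eq_on_frontier := fun z hz => by
      rw [hS.eq_conj z hz]
      ring }

theorem exists_section_exterior (hΩ : IsAnalyticDomain Ω γ) (hS : IsSchwarzFunction Ω V S)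
    (hw : w ∉ frontier Ω) (hwe : w ∈ exterior Ω) : ∃ f₁ f₂ : OnePoint ℂ → ℂ,
      (∀ z ∈ Ω, f₁ z = pieceG Ω z w) ∧ (∀ z ∈ exterior Ω, f₂ z = pieceF Ω z w) ∧
      (lambdaBundle hΩ hS hw).IsUniqueSection ValueOne f₁ f₂ ∧
      (∀ z ∈ collar V S w, f₁ z * (S z - conj w) = f₂ z) := by
  have hg := gluingData_exterior hΩ hS hwe
  have hd := isDensity_of_mem_exterior hΩ hwe
  have hm := hΩ.isOpen.measurableSet
  refine ⟨_, _, fun z hz => ?_, fun z hz => ?_, hg.isUniqueSection hΩ (fun z hz => ?_)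
    (fun z _ => Complex.exp_ne_zero _) rfl
    fun g hg1 hg2 => tendsto_div_of_valueOne hg1 hg2 hg.tendsto_snd, fun z hz => ?_⟩
  · rw [sectionFst_of_mem (subset_closure hz), pieceG, expTransform_of_isDensity hm hd]
  · rw [sectionSnd_of_notMem fun h => hz (subset_closure h), pieceF,
      expTransform_of_isDensity hm hd]
  · exact div_ne_zero (Complex.exp_ne_zero _) fun h =>
      hwe (star_injective (sub_eq_zero.1 h) ▸ hz)
  · rw [hg.relation hz]
    have := sub_ne_zero.2 hz.2
    field_simp

theorem gluingData_interior (hΩ : IsAnalyticDomain Ω γ) (hS : IsSchwarzFunction Ω V S)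
    (hw : w ∈ Ω) {r : ℝ} (hr : 0 < r) (hwr : Metric.ball w r ⊆ Ω) :
    GluingData Ω (collar V S w) (fun z => 1 / (S z - conj w)) (fun z => pieceH Ω z w)
      (fun z => Complex.exp (cauchyPotential (kernelDensity (Ω \ Metric.ball w r) w) z) / (z - w))
      0 := by
  have hm := hΩ.isOpen.measurableSet
  have hb := hΩ.isBounded
  have hwf : w ∉ frontier Ω := fun h => hΩ.frontier_disjoint h hw
  have hd : ∀ {r : ℝ}, 0 < r → IsDensity (kernelDensity (Ω \ Metric.ball w r) w) :=
    fun hr => isDensity_kernelDensity_sdiff hm hb hr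
  have hc := (hd hr).continuous_cauchyPotential
  have hle : ∀ z ∉ Ω, r ≤ ‖z - w‖ := fun z hz => by
    by_contra h
    exact hz (hwr (by rw [Metric.mem_ball, dist_eq_norm]; exact not_le.1 h))
  have hne : ∀ z ∉ Ω, z - w ≠ 0 := fun z hz h => hz (sub_eq_zero.1 h ▸ hw)
  have hinv : Tendsto (fun z : ℂ => (z - w)⁻¹) (Bornology.cobounded ℂ) (𝓝 0) :=
    tendsto_inv₀_cobounded.comp (tendsto_sub_const_cobounded w)
  exact {
    isOpen := isOpen_collar hS w
    frontier_subset := frontier_subset_collar hS hwf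
    differentiableOn := differentiableOn_one_div_sub hS w
    ne_zero := fun z hz => one_div_ne_zero (sub_ne_zero.2 hz.2)
    continuousOn_fst := by
      simp only [pieceH_eq hm hb hr hwr]
      refine ContinuousOn.div (by fun_prop) (by fun_prop) fun u _ => ?_
      have : (0 : ℝ) < max r ‖u - w‖ := lt_max_of_lt_left hr
      exact pow_ne_zero _ (by exact_mod_cast this.ne')
    differentiableOn_fst := fun z hz => by
      refine DifferentiableAt.differentiableWithinAt ?_
      by_cases hzw : z = w
      · subst hzw
        have h1 := ((hd hr).differentiableAt_cauchyPotential (z₀ := z) (by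
          filter_upwards [Metric.ball_mem_nhds z hr] with ζ hζ
            using indicator_of_notMem (fun h => h.2 hζ) _)).cexp.div_const ((r : ℂ) ^ 2)
        refine h1.congr_of_eventuallyEq ?_
        filter_upwards [Metric.ball_mem_nhds z hr] with ζ hζ
        rw [pieceH_eq hm hb hr hwr, max_eq_left]
        rw [← dist_eq_norm]
        exact (Metric.mem_ball.1 hζ).le
      · have hzw0 : 0 < ‖z - w‖ := norm_pos_iff.2 (sub_ne_zero.2 hzw)
        obtain ⟨ρ, hρ, hball⟩ := Metric.isOpen_iff.1 hΩ.isOpen z hz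
        -- Away from `w` a smaller removed disc is used, leaving a neighbourhood of `z` outside it.
        -- There the maximum is `|ζ - w|`, and `|ζ - w|² = (ζ - w) conj (ζ - w)` splits off the
        -- factor treated in the exterior case.
        set η := min r (‖z - w‖ / 2) with hη
        have hη0 : 0 < η := by positivity
        have hηr : Metric.ball w η ⊆ Ω :=
          (Metric.ball_subset_ball (min_le_left _ _)).trans hwr
        set σ := min ρ (‖z - w‖ / 2) with hσ
        have hσ0 : 0 < σ := by positivity
        have hfar : ∀ ζ ∈ Metric.ball z σ, η ≤ ‖ζ - w‖ := fun ζ hζ => by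
          rw [Metric.mem_ball, dist_comm, dist_eq_norm] at hζ
          have h1 := norm_sub_le_norm_sub_add_norm_sub z ζ w
          have h2 := min_le_right r (‖z - w‖ / 2)
          have h3 := min_le_right ρ (‖z - w‖ / 2)
          linarith
        have h1 := differentiableAt_exp_cauchyPotential_div (z₀ := z) (hd hη0) hσ0
          (fun ζ hζ => ⟨hball (Metric.ball_subset_ball (min_le_left _ _) hζ), fun h => by
            rw [Metric.mem_ball, dist_eq_norm] at h
            exact absurd h (not_lt.2 (hfar ζ hζ))⟩) (fun h => h.2 (Metric.mem_ball_self hη0))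
        have h2 : DifferentiableAt ℂ (fun ζ => (ζ - w)⁻¹) z :=
          DifferentiableAt.inv (by fun_prop) (sub_ne_zero.2 hzw)
        refine (h1.mul h2).congr_of_eventuallyEq ?_
        filter_upwards [Metric.ball_mem_nhds z hσ0] with ζ hζ
        have hf := hfar ζ hζ
        have hζw : ζ - w ≠ 0 := norm_pos_iff.1 (hη0.trans_le hf)
        simp only [Pi.mul_apply]
        rw [pieceH_eq hm hb hη0 hηr, max_eq_right hf, ← Complex.ofReal_pow,
          ← Complex.normSq_eq_norm_sq, ← Complex.mul_conj, ← map_sub, div_mul_eq_div_div_swap,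
          div_eq_mul_inv (_ / _)]
    continuousOn_snd := ContinuousOn.div (by fun_prop) (by fun_prop) hne
    differentiableOn_snd := ((differentiableOn_cauchyPotential_exterior (hd hr)
      fun ζ hζ => indicator_of_notMem (fun h => hζ h.1) _).cexp).fun_div (by fun_prop)
        fun z hz => hne z fun h => hz (subset_closure h)
    tendsto_snd := by
      simpa [div_eq_mul_inv] using (tendsto_exp_cauchyPotential (hd hr)).mul hinv
    eq_on_frontier := fun z hz => by
      have hzΩ : z ∉ Ω := hΩ.frontier_disjoint hz
      rw [hS.eq_conj z hz, pieceH_eq hm hb hr hwr, max_eq_right (hle z hzΩ), ← Complex.ofReal_pow,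
        ← Complex.normSq_eq_norm_sq, ← Complex.mul_conj, ← map_sub, div_mul_div_comm, one_mul,
        mul_comm (z - w)] }

theorem leadingTermInv_of_eq {g : ℂ → ℂ} (hg : IsDensity g) {f : OnePoint ℂ → ℂ}
    (hf : ∀ᶠ z : ℂ in Bornology.cobounded ℂ, f z = Complex.exp (cauchyPotential g z) / (z - w)) :
    LeadingTermInv f := by
  have hsub : (fun z : ℂ => (z - w)⁻¹) =O[Bornology.cobounded ℂ] fun z => z⁻¹ := by
    refine IsBigO.of_bound 2 ?_
    filter_upwards [tendsto_norm_cobounded_atTop.eventually_ge_atTop (2 * ‖w‖ + 1)] with z hz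
    have h1 := norm_sub_norm_le z w
    have h0 := norm_nonneg w
    rw [norm_inv, norm_inv, ← div_eq_mul_inv, inv_eq_one_div, div_le_div_iff₀ (by linarith)
      (by linarith)]
    linarith
  have hexp : (fun z => Complex.exp (cauchyPotential g z) - 1) =O[Bornology.cobounded ℂ]
      fun z => z⁻¹ := by
    have h1 : (fun u : ℂ => Complex.exp u - 1) =O[𝓝 0] fun u => u := by
      simpa using (Complex.hasDerivAt_exp 0).isBigO_sub
    exact (h1.comp_tendsto (tendsto_cauchyPotential hg)).trans hg.isBigO_cauchyPotential
  -- With `u` the potential, `e^u / (z - w) - 1 / z = (e^u - 1) / (z - w) + w / (z (z - w))`, and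
  -- both terms are `O(z⁻²)`.
  have hsum := (hexp.mul hsub).add
    (((isBigO_refl (fun z : ℂ => z⁻¹) (Bornology.cobounded ℂ)).mul hsub).const_mul_left w)
  refine hsum.congr' ?_ ?_
  · filter_upwards [hf, Bornology.eventually_ne_cobounded (0 : ℂ),
      Bornology.eventually_ne_cobounded w] with z h1 h2 h3
    have := sub_ne_zero.2 h3
    rw [h1]
    field_simp
    ring
  · exact Eventually.of_forall fun z => by ring

theorem exists_section_interior (hΩ : IsAnalyticDomain Ω γ) (hS : IsSchwarzFunction Ω V S)
    (hw : w ∉ frontier Ω) (hwi : w ∈ Ω) : ∃ f₁ f₂ : OnePoint ℂ → ℂ,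
      (∀ z ∈ Ω, f₁ z = pieceH Ω z w) ∧ (∀ z ∈ exterior Ω, f₂ z = -pieceGstar Ω z w) ∧
      (lambdaBundle hΩ hS hw).IsUniqueSection LeadingTermInv f₁ f₂ ∧
      (∀ z ∈ collar V S w, f₁ z * (S z - conj w) = f₂ z) := by
  obtain ⟨r, hr, hwr⟩ := Metric.isOpen_iff.1 hΩ.isOpen w hwi
  have hg := gluingData_interior hΩ hS hwi hr hwr
  have hm := hΩ.isOpen.measurableSet
  have hb := hΩ.isBounded
  have hle : ∀ z ∉ Ω, r ≤ ‖z - w‖ := fun z hz => by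
    by_contra h
    exact hz (hwr (by rw [Metric.mem_ball, dist_eq_norm]; exact not_le.1 h))
  have hsnd : ∀ z ∈ exterior Ω, sectionSnd Ω (fun z => 1 / (S z - conj w)) (fun z => pieceH Ω z w)
      (fun z => Complex.exp (cauchyPotential (kernelDensity (Ω \ Metric.ball w r) w) z) / (z - w))
      0 z = Complex.exp (cauchyPotential (kernelDensity (Ω \ Metric.ball w r) w) z) / (z - w) :=
    fun z hz => sectionSnd_of_notMem fun h => hz (subset_closure h)
  have hP := leadingTermInv_of_eq (isDensity_kernelDensity_sdiff (w := w) hm hb hr)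
    (mem_of_superset (GluingData.exterior_mem_cobounded hΩ) hsnd)
  refine ⟨_, _, fun z hz => ?_, fun z hz => ?_, hg.isUniqueSection hΩ (fun z _ => ?_)
    (fun z hz => ?_) hP fun g _ hg2 => ?_, fun z hz => ?_⟩
  · rw [sectionFst_of_mem (subset_closure hz)]
  · have hzΩ : z ∉ Ω := fun h => hz (subset_closure h)
    rw [hsnd z hz, pieceGstar, pieceG, map_div₀, conj_expTransform, map_sub, Complex.conj_conj,
      Complex.conj_conj, expTransform_of_le hm hb hr hwr (hle z hzΩ), ← div_neg, neg_sub]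
  · rw [pieceH_eq hm hb hr hwr]
    have : (0 : ℝ) < max r ‖z - w‖ := lt_max_of_lt_left hr
    exact div_ne_zero (Complex.exp_ne_zero _) (pow_ne_zero _ (by exact_mod_cast this.ne'))
  · exact div_ne_zero (Complex.exp_ne_zero _) fun h => hz (sub_eq_zero.1 h ▸ hwi)
  · refine (tendsto_div_of_leadingTermInv hg2 hP).congr' ?_
    filter_upwards [GluingData.exterior_mem_cobounded hΩ] with z hz
    rw [hsnd z hz]
  · rw [hg.relation hz]
    have := sub_ne_zero.2 hz.2
    field_simp

/-- The inner exponent is written `conj z - C_Ω z` because this is continuous up to the boundary,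
where the boundary integral is singular; there `conj z = S z` gives the matching. -/
theorem gluingData_exp (hΩ : IsAnalyticDomain Ω γ) (hS : IsSchwarzFunction Ω V S) :
    GluingData Ω V (fun z => Complex.exp (S z))
      (fun z => Complex.exp (conj z - cauchyTransform Ω z))
      (fun z => Complex.exp (-cauchyTransform Ω z)) 1 := by
  have hm := hΩ.isOpen.measurableSet
  have hd := isDensity_one hm hΩ.isBounded
  have hc := hd.continuous_cauchyPotential
  have hT : cauchyTransform Ω = cauchyPotential (Ω.indicator fun _ => 1) :=
    funext (cauchyTransform_eq hm)
  rw [hT]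
  exact {
    isOpen := hS.isOpen
    frontier_subset := hS.frontier_subset
    differentiableOn := hS.holomorphic.cexp
    ne_zero := fun _ _ => Complex.exp_ne_zero _
    continuousOn_fst := by fun_prop
    differentiableOn_fst := fun z hz => by
      obtain ⟨ρ, hρ, hball⟩ := Metric.isOpen_iff.1 hΩ.isOpen z hz
      have h := (hd.differentiableAt_cauchyPotential_sub_conj (z₀ := z) (P := id) (h := fun _ => 1) hρ
        (fun ζ _ => hasDerivAt_id ζ) fun ζ hζ => by simp [hball hζ]).neg.cexp
      refine (h.congr_of_eventuallyEq (Eventually.of_forall fun ζ => ?_)).differentiableWithinAt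
      simp
    continuousOn_snd := by fun_prop
    differentiableOn_snd := (differentiableOn_cauchyPotential_exterior hd
      fun ζ hζ => indicator_of_notMem hζ _).fun_neg.cexp
    tendsto_snd := by simpa using (tendsto_cauchyPotential hd).neg.cexp
    eq_on_frontier := fun z hz => by
      rw [hS.eq_conj z hz, ← Complex.exp_add, sub_eq_add_neg] }

theorem exists_section_exp (hΩ : IsAnalyticDomain Ω γ) (hS : IsSchwarzFunction Ω V S) :
    ∃ f₁ f₂ : OnePoint ℂ → ℂ,
      (∀ z ∈ Ω, f₁ z = Complex.exp (exteriorCauchy γ z)) ∧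
      (∀ z ∈ exterior Ω, f₂ z = Complex.exp (-cauchyTransform Ω z)) ∧
      (expBundle hΩ hS).IsUniqueSection ValueOne f₁ f₂ := by
  have hg := gluingData_exp hΩ hS
  refine ⟨_, _, fun z hz => ?_, fun z hz => ?_, hg.isUniqueSection hΩ
    (fun z _ => Complex.exp_ne_zero _) (fun z _ => Complex.exp_ne_zero _) rfl
    fun g hg1 hg2 => tendsto_div_of_valueOne hg1 hg2 hg.tendsto_snd⟩
  · rw [sectionFst_of_mem (subset_closure hz), hΩ.exteriorCauchy_eq hz]
  · rw [sectionSnd_of_notMem fun h => hz (subset_closure h)]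

end

/-! ### The limit `w → ∞` -/

theorem tendsto_inv_conj_cobounded :
    Tendsto (fun w : ℂ => (conj w)⁻¹) (Bornology.cobounded ℂ) (𝓝 0) := by
  have h := (Complex.continuous_conj.tendsto (0 : ℂ)).comp (tendsto_inv₀_cobounded (α := ℂ))
  rw [map_zero] at h
  exact h.congr fun w => map_inv₀ _ _

/-- The hypothesis forces `L → 0`, so eventually `L w` is the principal logarithm of `b w` and the
power is `exp (conj w * L w)`. -/
theorem tendsto_cpow_conj {L b : ℂ → ℂ} {ℓ : ℂ}
    (hL : Tendsto (fun w => conj w * L w) (Bornology.cobounded ℂ) (𝓝 ℓ))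
    (hb : ∀ᶠ w in Bornology.cobounded ℂ, b w = Complex.exp (L w)) :
    Tendsto (fun w => b w ^ conj w) (Bornology.cobounded ℂ) (𝓝 (Complex.exp ℓ)) := by
  have hL0 : Tendsto L (Bornology.cobounded ℂ) (𝓝 0) := by
    have h := tendsto_inv_conj_cobounded.mul hL
    rw [zero_mul] at h
    refine h.congr' ?_
    filter_upwards [Bornology.eventually_ne_cobounded (0 : ℂ)] with w hw
    rw [inv_mul_cancel_left₀ ((map_ne_zero _).2 hw)]
  have him : Tendsto (fun w => (L w).im) (Bornology.cobounded ℂ) (𝓝 0) := by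
    exact (Complex.continuous_im.tendsto 0).comp hL0
  refine hL.cexp.congr' ?_
  filter_upwards [hb, him.eventually_const_lt (neg_lt_zero.2 Real.pi_pos),
    him.eventually_lt_const Real.pi_pos] with w h1 h2 h3
  rw [h1, Complex.cpow_def_of_ne_zero (Complex.exp_ne_zero _), Complex.log_exp h2 h3.le, mul_comm]

/-- The difference quotient at `0` of `u ↦ log (1 - s u)`, taken along `u = 1 / conj w`. -/
theorem tendsto_conj_mul_log (s : ℂ) :
    Tendsto (fun w : ℂ => conj w * Complex.log (1 - s / conj w)) (Bornology.cobounded ℂ)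
      (𝓝 (-s)) := by
  have hd : HasDerivAt (fun u : ℂ => Complex.log (1 - s * u)) (-s) 0 := by
    have h1 : HasDerivAt (fun u : ℂ => 1 - s * u) (-s) 0 := by
      simpa using ((hasDerivAt_id (0 : ℂ)).const_mul s).const_sub 1
    simpa using h1.clog (by simp)
  have hne : Tendsto (fun w : ℂ => (conj w)⁻¹) (Bornology.cobounded ℂ) (𝓝[≠] 0) := by
    refine tendsto_nhdsWithin_iff.2 ⟨tendsto_inv_conj_cobounded, ?_⟩
    filter_upwards [Bornology.eventually_ne_cobounded (0 : ℂ)] with w hw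
    exact inv_ne_zero ((map_ne_zero _).2 hw)
  refine (hd.tendsto_slope_zero.comp hne).congr fun w => ?_
  simp [div_eq_mul_inv]

theorem exp_log_one_sub_div_conj (s : ℂ) : ∀ᶠ w : ℂ in Bornology.cobounded ℂ,
    conj w ≠ 0 ∧ 1 - s / conj w ≠ 0 ∧
      Complex.exp (Complex.log (1 - s / conj w)) = 1 - s / conj w := by
  have h : Tendsto (fun w : ℂ => 1 - s / conj w) (Bornology.cobounded ℂ) (𝓝 1) := by
    simpa [div_eq_mul_inv] using (tendsto_inv_conj_cobounded.const_mul s).const_sub 1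
  filter_upwards [h.eventually_ne one_ne_zero, Bornology.eventually_ne_cobounded (0 : ℂ)]
    with w h1 h2
  exact ⟨(map_ne_zero _).2 h2, h1, Complex.exp_log h1⟩

theorem tendsto_conj_mul_kernel (ζ : ℂ) :
    Tendsto (fun w : ℂ => conj w * (conj (ζ - w))⁻¹) (Bornology.cobounded ℂ) (𝓝 (-1)) := by
  have h1 : Tendsto (fun w : ℂ => (w - ζ)⁻¹) (Bornology.cobounded ℂ) (𝓝 0) :=
    tendsto_inv₀_cobounded.comp (tendsto_sub_const_cobounded ζ)
  have h2 := ((h1.const_mul ζ).const_add 1).neg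
  rw [mul_zero, add_zero] at h2
  have h3 := (Complex.continuous_conj.tendsto (-1 : ℂ)).comp h2
  rw [map_neg, map_one] at h3
  refine h3.congr' ?_
  filter_upwards [Bornology.eventually_ne_cobounded ζ] with w hw
  have hw' := sub_ne_zero.2 hw
  have hw'' := sub_ne_zero.2 hw.symm
  rw [Function.comp_apply, ← map_inv₀, ← map_mul]
  congr 1
  rw [← neg_sub w ζ, inv_neg]
  field_simp
  ring

/-- Dominated convergence: `conj w / conj (ζ - w) → -1` pointwise, and its modulus is at most `2`
once `|w| ≥ 2R`. -/
theorem tendsto_conj_mul_cauchyPotential {Ω : Set ℂ} (hm : MeasurableSet Ω)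
    (hb : Bornology.IsBounded Ω) (z : ℂ) :
    Tendsto (fun w => conj w * cauchyPotential (kernelDensity Ω w) z) (Bornology.cobounded ℂ)
      (𝓝 (-cauchyTransform Ω z)) := by
  obtain ⟨R, hR0, hR⟩ := hb.exists_pos_norm_le
  have : (Bornology.cobounded ℂ).IsCountablyGenerated := by
    rw [← comap_norm_atTop]
    infer_instance
  have key : Tendsto (fun w => ∫ ζ, conj w * (kernelDensity Ω w ζ * (z - ζ)⁻¹))
      (Bornology.cobounded ℂ) (𝓝 (∫ ζ, -(Ω.indicator (fun _ => 1) ζ * (z - ζ)⁻¹))) := by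
    refine tendsto_integral_filter_of_dominated_convergence
      (fun ζ => 2 * ‖Ω.indicator (fun _ => (1 : ℂ)) ζ * (z - ζ)⁻¹‖)
      (Eventually.of_forall fun w => ?_) ?_
      (((isDensity_one hm hb).integrable_mul_inv z).norm.const_mul 2)
      (Eventually.of_forall fun ζ => ?_)
    · have hk : Measurable (kernelDensity Ω w) := by
        unfold kernelDensity
        exact Measurable.indicator (by fun_prop) hm
      exact (by fun_prop : Measurable _).aestronglyMeasurable
    · filter_upwards [tendsto_norm_cobounded_atTop.eventually_ge_atTop (2 * R)] with w hw
      refine Eventually.of_forall fun ζ => ?_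
      by_cases hζ : ζ ∈ Ω
      · have h1 := norm_sub_norm_le w ζ
        have h2 := hR ζ hζ
        rw [kernelDensity, indicator_of_mem hζ, indicator_of_mem hζ, one_mul, ← mul_assoc,
          norm_mul, norm_mul, norm_inv, Complex.norm_conj, Complex.norm_conj, norm_sub_rev ζ w]
        gcongr
        rw [← div_eq_mul_inv, div_le_iff₀ (by linarith)]
        linarith
      · simp [kernelDensity, hζ]
    · by_cases hζ : ζ ∈ Ω
      · simpa [kernelDensity, hζ, mul_assoc] using
          (tendsto_conj_mul_kernel ζ).mul_const (z - ζ)⁻¹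
      · simp [kernelDensity, hζ]
  rw [cauchyTransform_eq hm, cauchyPotential, ← mul_neg, ← integral_neg]
  refine (key.const_mul _).congr fun w => ?_
  rw [integral_const_mul, cauchyPotential]
  ring

section

variable {Ω : Set ℂ} {γ : ℝ → ℂ}

theorem tendsto_transition_cpow (s : ℂ) :
    Tendsto (fun w : ℂ => (-conj w * (1 / (s - conj w))) ^ (conj w))
      (Bornology.cobounded ℂ) (𝓝 (Complex.exp s)) := by
  have h := (tendsto_conj_mul_log s).neg
  rw [neg_neg] at h
  refine tendsto_cpow_conj (L := fun w => -Complex.log (1 - s / conj w))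
    (h.congr fun w => by ring) ?_
  filter_upwards [exp_log_one_sub_div_conj s] with w ⟨h1, h2, h3⟩
  have h4 : s - conj w ≠ 0 := fun h => h2 (by rw [sub_eq_zero.1 h, div_self h1, sub_self])
  have h5 : conj w - s ≠ 0 := fun h => h4 (by rw [← neg_sub, h, neg_zero])
  rw [Complex.exp_neg, h3, ← neg_sub (conj w) s]
  field_simp

theorem tendsto_pieceF_cpow (hΩ : IsAnalyticDomain Ω γ) (z : ℂ) :
    Tendsto (fun w : ℂ => (pieceF Ω z w) ^ (conj w)) (Bornology.cobounded ℂ)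
      (𝓝 (Complex.exp (-cauchyTransform Ω z))) := by
  have hm := hΩ.isOpen.measurableSet
  refine tendsto_cpow_conj (tendsto_conj_mul_cauchyPotential hm hΩ.isBounded z) ?_
  filter_upwards [GluingData.exterior_mem_cobounded hΩ] with w hw
  exact expTransform_of_isDensity hm (isDensity_of_mem_exterior hΩ hw) z

theorem tendsto_pieceG_cpow (hΩ : IsAnalyticDomain Ω γ) {z : ℂ} (hz : z ∈ Ω) :
    Tendsto (fun w : ℂ => (-conj w * pieceG Ω z w) ^ (conj w)) (Bornology.cobounded ℂ)
      (𝓝 (Complex.exp (exteriorCauchy γ z))) := by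
  have hm := hΩ.isOpen.measurableSet
  -- Since `-conj w / (conj z - conj w) = 1 / (1 - conj z / conj w)`, the base is the exponential of
  -- the potential minus `log (1 - conj z / conj w)`. The limiting exponent is `conj z - C_Ω z`.
  have h := (tendsto_conj_mul_cauchyPotential hm hΩ.isBounded z).sub
    (tendsto_conj_mul_log (conj z))
  rw [sub_neg_eq_add, neg_add_eq_sub, ← hΩ.exteriorCauchy_eq hz] at h
  refine tendsto_cpow_conj (L := fun w => cauchyPotential (kernelDensity Ω w) z -
    Complex.log (1 - conj z / conj w)) (h.congr fun w => by ring) ?_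
  filter_upwards [exp_log_one_sub_div_conj (conj z), GluingData.exterior_mem_cobounded hΩ]
    with w ⟨h1, h2, h3⟩ hw
  have h4 : conj z - conj w ≠ 0 := fun h => h2 (by rw [sub_eq_zero.1 h, div_self h1, sub_self])
  have h5 : conj w - conj z ≠ 0 := fun h => h4 (by rw [← neg_sub, h, neg_zero])
  rw [Complex.exp_sub, h3, pieceG,
    expTransform_of_isDensity hm (isDensity_of_mem_exterior hΩ hw), ← neg_sub (conj w)]
  field_simp

end

end SchwarzBundle

/-! ### The main theorem -/

theorem mainTheorem1 (Ω V : Set ℂ) (γ : ℝ → ℂ) (S : ℂ → ℂ)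
    (hΩ : SchwarzBundle.IsAnalyticDomain Ω γ) (hS : SchwarzBundle.IsSchwarzFunction Ω V S) :
    -- the sections in the first variable, for fixed `w`
    (∀ (w : ℂ) (hw : w ∉ frontier Ω),
      (w ∈ SchwarzBundle.exterior Ω → ∃ f₁ f₂ : OnePoint ℂ → ℂ,
        (∀ z ∈ Ω, f₁ z = SchwarzBundle.pieceG Ω z w) ∧
        (∀ z ∈ SchwarzBundle.exterior Ω, f₂ z = SchwarzBundle.pieceF Ω z w) ∧
        (SchwarzBundle.lambdaBundle hΩ hS hw).IsUniqueSection SchwarzBundle.ValueOne f₁ f₂ ∧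
        (∀ z ∈ SchwarzBundle.collar V S w, f₁ z * (S z - conj w) = f₂ z)) ∧
      (w ∈ Ω → ∃ f₁ f₂ : OnePoint ℂ → ℂ,
        (∀ z ∈ Ω, f₁ z = SchwarzBundle.pieceH Ω z w) ∧
        (∀ z ∈ SchwarzBundle.exterior Ω, f₂ z = -SchwarzBundle.pieceGstar Ω z w) ∧
        (SchwarzBundle.lambdaBundle hΩ hS hw).IsUniqueSection SchwarzBundle.LeadingTermInv f₁ f₂ ∧
        (∀ z ∈ SchwarzBundle.collar V S w, f₁ z * (S z - conj w) = f₂ z))) ∧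
    -- the sections in the second variable, for fixed `z`
    (∀ (z : ℂ) (hz : z ∉ frontier Ω),
      (z ∈ SchwarzBundle.exterior Ω → ∃ f₁ f₂ : OnePoint ℂ → ℂ,
        (∀ w ∈ Ω, f₁ w = conj (SchwarzBundle.pieceGstar Ω z w)) ∧
        (∀ w ∈ SchwarzBundle.exterior Ω, f₂ w = conj (SchwarzBundle.pieceF Ω z w)) ∧
        (SchwarzBundle.lambdaBundle hΩ hS hz).IsUniqueSection SchwarzBundle.ValueOne f₁ f₂ ∧
        (∀ w ∈ SchwarzBundle.collar V S z, f₁ w * (S w - conj z) = f₂ w)) ∧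
      (z ∈ Ω → ∃ f₁ f₂ : OnePoint ℂ → ℂ,
        (∀ w ∈ Ω, f₁ w = conj (SchwarzBundle.pieceH Ω z w)) ∧
        (∀ w ∈ SchwarzBundle.exterior Ω, f₂ w = -conj (SchwarzBundle.pieceG Ω z w)) ∧
        (SchwarzBundle.lambdaBundle hΩ hS hz).IsUniqueSection SchwarzBundle.LeadingTermInv f₁ f₂ ∧
        (∀ w ∈ SchwarzBundle.collar V S z, f₁ w * (S w - conj z) = f₂ w))) ∧
    -- the section of the bundle `exp S`
    (∃ f₁ f₂ : OnePoint ℂ → ℂ,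
      (∀ z ∈ Ω, f₁ z = Complex.exp (SchwarzBundle.exteriorCauchy γ z)) ∧
      (∀ z ∈ SchwarzBundle.exterior Ω,
        f₂ z = Complex.exp (-SchwarzBundle.cauchyTransform Ω z)) ∧
      (SchwarzBundle.expBundle hΩ hS).IsUniqueSection SchwarzBundle.ValueOne f₁ f₂) ∧
    -- it is the limiting case `w → ∞` of the sections for `w` in the exterior domain
    (∀ z ∈ V, Tendsto (fun w : ℂ => (-conj w * (1 / (S z - conj w))) ^ (conj w))
      (Bornology.cobounded ℂ) (𝓝 (Complex.exp (S z)))) ∧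
    (∀ z ∈ Ω, Tendsto (fun w : ℂ => (-conj w * SchwarzBundle.pieceG Ω z w) ^ (conj w))
      (Bornology.cobounded ℂ) (𝓝 (Complex.exp (SchwarzBundle.exteriorCauchy γ z)))) ∧
    (∀ z ∈ SchwarzBundle.exterior Ω,
      Tendsto (fun w : ℂ => (SchwarzBundle.pieceF Ω z w) ^ (conj w))
        (Bornology.cobounded ℂ) (𝓝 (Complex.exp (-SchwarzBundle.cauchyTransform Ω z)))) := by
  refine ⟨fun w hw => ⟨SchwarzBundle.exists_section_exterior hΩ hS hw,
    SchwarzBundle.exists_section_interior hΩ hS hw⟩, fun z hz => ⟨fun hze => ?_, fun hzi => ?_⟩,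
    SchwarzBundle.exists_section_exp hΩ hS,
    fun z _ => SchwarzBundle.tendsto_transition_cpow (S z),
    fun z hz => SchwarzBundle.tendsto_pieceG_cpow hΩ hz,
    fun z _ => SchwarzBundle.tendsto_pieceF_cpow hΩ z⟩
  · obtain ⟨f₁, f₂, h1, h2, h3⟩ := SchwarzBundle.exists_section_exterior hΩ hS hz hze
    refine ⟨f₁, f₂, fun w hw => ?_, fun w hw => ?_, h3⟩
    · rw [h1 w hw, SchwarzBundle.pieceGstar, Complex.conj_conj]
    · rw [h2 w hw, SchwarzBundle.pieceF, SchwarzBundle.pieceF, SchwarzBundle.conj_expTransform]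
  · obtain ⟨f₁, f₂, h1, h2, h3⟩ := SchwarzBundle.exists_section_interior hΩ hS hz hzi
    -- The exterior component needs no rewriting: `G*` with its arguments exchanged is by definition
    -- the conjugate of `G`.
    refine ⟨f₁, f₂, fun w hw => ?_, h2, h3⟩
    rw [h1 w hw, SchwarzBundle.conj_pieceH hΩ.isOpen hΩ.isBounded hw]
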